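/- All graphs are finite and simple. A graph is outerplanar if it can be embedded in the plane without crossings so that every vertex lies on the boundary of the outer (unbounded) face; it is 2-connected if it has at least three vertices, is connected, and remains connected after the deletion of any one vertex. An orientation $D$ of a graph $G$ gives each edge of $G$ exactly one of its two directions. For a set $H$ of arcs of $D$, write $d_H^+(v)$ and $d_H^-(v)$ for the numbers of arcs of $H$ that leave and enter $v$, respectively. The set $H$ is called Eulerian if $d_H^+(v)=d_H^-(v)$ for every vertex $v$ (so $H=\emptyset$ is Eulerian). Let $\mathcal{E}_e(D)$ and $\mathcal{E}_o(D)$ be the families of Eulerian sets $H$ of arcs of $D$ with $|H|$ even and with $|H|$ odd, respectively. The orientation $D$ is an Alon–Tarsi orientation if $|\mathcal{E}_e(D)|\neq|\mathcal{E}_o(D)|$. For a positive integer $k$, the graph $G$ is $k$-truncated degree-AT if it has an Alon–Tarsi orientation $D$ with $$d_D^+(v)<\min\{k,d_G(v)\}\quad\text{for every vertex } v,$$ where $d_D^+(v)$ is the out-degree of $v$ in $D$ and $d_G(v)$ is the degree of $v$ in $G$. **Theorem.** Every 2-connected outerplanar graph that is not an odd cycle is 5-truncated degree-AT. -/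

import Mathlib

/-! ### Connectivity and odd cycles -/

/-- `G` is 2-connected: it has at least three vertices, it is connected, and it stays connected
when any one vertex is deleted. -/
structure IsTwoConnected {V : Type*} [Fintype V] (G : SimpleGraph V) : Prop where
  three_le_card : 3 ≤ Fintype.card V
  connected : G.Connected
  connected_delete : ∀ v : V, (G.induce {u : V | u ≠ v}).Connected

/-- `G` is (isomorphic to) a cycle of odd length. -/
def IsOddCycle {V : Type*} (G : SimpleGraph V) : Prop :=
  ∃ n : ℕ, 3 ≤ n ∧ Odd n ∧ Nonempty (G ≃g SimpleGraph.cycleGraph n)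

/-! ### Plane drawings and outerplanar graphs -/

/-- The Euclidean plane. -/
abbrev Plane : Type := EuclideanSpace ℝ (Fin 2)

/-- An embedding of `G` in the plane without crossings: distinct vertices are distinct points,
every edge `uv` is a simple arc joining the points `u` and `v`, no arc passes through a vertex
other than its two ends, and two different arcs meet only in common ends. -/
structure PlaneEmbedding {V : Type*} (G : SimpleGraph V) where
  /-- the point representing a vertex -/
  point : V → Plane
  /-- the point set of the arc representing an edge (only its values on edges of `G` matter) -/
  arc : Sym2 V → Set Plane
  point_injective : Function.Injective point
  arc_simple : ∀ u v : V, G.Adj u v →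
    ∃ γ : Path (point u) (point v), Function.Injective γ ∧ Set.range γ = arc s(u, v)
  vertex_mem_arc : ∀ e ∈ G.edgeSet, ∀ v : V, point v ∈ arc e → v ∈ e
  arc_inter : ∀ e ∈ G.edgeSet, ∀ f ∈ G.edgeSet, e ≠ f →
    arc e ∩ arc f ⊆ point '' {v : V | v ∈ e ∧ v ∈ f}

namespace PlaneEmbedding

variable {V : Type*} {G : SimpleGraph V}

/-- The set of all points of the plane that lie on the drawn graph. -/
def carrier (Γ : PlaneEmbedding G) : Set Plane :=
  Set.range Γ.point ∪ ⋃ e ∈ G.edgeSet, Γ.arc e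

/-- `F` is a face: a connected component of the complement of the drawn graph. -/
def IsFace (Γ : PlaneEmbedding G) (F : Set Plane) : Prop :=
  ∃ x ∈ Γ.carrierᶜ, F = connectedComponentIn Γ.carrierᶜ x

/-- `F` is the outer face: the unbounded face. -/
def IsOuterFace (Γ : PlaneEmbedding G) (F : Set Plane) : Prop :=
  Γ.IsFace F ∧ ¬ Bornology.IsBounded F

end PlaneEmbedding

/-- `G` is outerplanar: it has a plane embedding in which every vertex lies on the boundary of the
outer face. -/
def IsOuterplanar {V : Type*} (G : SimpleGraph V) : Prop :=
  ∃ (Γ : PlaneEmbedding G) (F : Set Plane),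
    Γ.IsOuterFace F ∧ ∀ v : V, Γ.point v ∈ frontier F

/-! ### Alon–Tarsi orientations

A digraph on `V` is given by its finite set of arcs; `(u, v)` is the arc from `u` to `v`. -/

section AlonTarsi

variable {V : Type*} [DecidableEq V]

/-- `D` is an orientation of `G`: every arc of `D` comes from an edge of `G`, and for every edge
`uv` of `G` exactly one of `(u, v)`, `(v, u)` is an arc of `D`. -/
structure IsOrientation (G : SimpleGraph V) (D : Finset (V × V)) : Prop where
  adj_of_mem : ∀ u v : V, (u, v) ∈ D → G.Adj u v
  mem_xor_mem : ∀ u v : V, G.Adj u v → Xor ((u, v) ∈ D) ((v, u) ∈ D)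

/-- The out-degree of `v` in the digraph with arc set `H`. -/
def outDeg (H : Finset (V × V)) (v : V) : ℕ := (H.filter fun a => a.1 = v).card

/-- The in-degree of `v` in the digraph with arc set `H`. -/
def inDeg (H : Finset (V × V)) (v : V) : ℕ := (H.filter fun a => a.2 = v).card

/-- The digraph with arc set `H` is Eulerian: in-degree equals out-degree at every vertex. -/
def IsEulerian (H : Finset (V × V)) : Prop := ∀ v : V, outDeg H v = inDeg H v

open Classical in
/-- The Eulerian sub-digraphs of `D` (the one without arcs included), as sets of arcs. -/
noncomputable def eulerianSubdigraphs (D : Finset (V × V)) : Finset (Finset (V × V)) :=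
  D.powerset.filter fun H => IsEulerian H

/-- The Eulerian sub-digraphs of `D` with an even number of arcs. -/
noncomputable def evenEulerian (D : Finset (V × V)) : Finset (Finset (V × V)) :=
  (eulerianSubdigraphs D).filter fun H => Even H.card

/-- The Eulerian sub-digraphs of `D` with an odd number of arcs. -/
noncomputable def oddEulerian (D : Finset (V × V)) : Finset (Finset (V × V)) :=
  (eulerianSubdigraphs D).filter fun H => Odd H.card

/-- The number of even minus the number of odd Eulerian sub-digraphs of `D`. -/
noncomputable def eulerianDiff (D : Finset (V × V)) : ℤ :=
  ((evenEulerian D).card : ℤ) - ((oddEulerian D).card : ℤ)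

/-- `D` is an Alon–Tarsi orientation of `G`. -/
def IsATOrientation (G : SimpleGraph V) (D : Finset (V × V)) : Prop :=
  IsOrientation G D ∧ eulerianDiff D ≠ 0

/-- `G` is `f`-AT: it has an Alon–Tarsi orientation with `d⁺(v) < f v` at every vertex `v`. -/
def IsAT (G : SimpleGraph V) (f : V → ℕ) : Prop :=
  ∃ D : Finset (V × V), IsATOrientation G D ∧ ∀ v : V, outDeg D v < f v

/-- `G` is `k`-truncated degree-AT: it is `f`-AT for `f v = min {k, d_G(v)}`. -/
def IsTruncatedDegreeAT [Fintype V] (k : ℕ) (G : SimpleGraph V) [DecidableRel G.Adj] : Prop :=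
  IsAT G fun v => min k (G.degree v)

end AlonTarsi

/-! A 2-connected outerplanar graph has a Hamiltonian cycle, and its other edges are pairwise
non-crossing chords, so it is a dissected polygon. This is obtained by excluding subdivisions of K₄
and K₂,₃: an extra vertex in the outer face, joined to the branch vertices, would turn them into
drawings of K₅ and K₃,₃. Those are refuted by winding numbers, through a parity count
(`exists_winding`).

Orientations are replaced by the product of `X u + X v` over the edges, modulo two. Signs vanish,
and the coefficient at the out-degree sequence of an orientation is its number of Eulerian
sub-digraphs modulo two. An odd number cannot split evenly into the even and the odd ones, so a
monomial with nonzero coefficient and exponents below the bounds suffices (`isAT_of_coeff_ne_zero`).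

Such a monomial is found by induction on strips of the dissection (`IsDissection.realizes`). With
the inner exponents fixed, a strip leaves a homogeneous polynomial in its two end variables, stored
as a bit mask. Strips are glued at a common end, which multiplies the polynomials and fixes the
exponent there, and the edge between the ends multiplies by their sum. A short list of states is
closed under both operations, which is a finite check. The whole polygon then offers the exponents 2
and 1 at the ends of the root edge, which are admissible once the vertex 0 has degree at least
three.

If no such vertex exists, the graph is a cycle. It is even by hypothesis, and its cyclic orientation
has only two Eulerian sub-digraphs, both with an even number of arcs. -/

open MvPolynomial

/-! ### The graph polynomial modulo two -/

/-- The product of the binomials `X u + X v` over the pairs `(u, v)` in `S`, modulo two. -/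
noncomputable def graphPoly {σ : Type*} (S : Finset (σ × σ)) : MvPolynomial σ (ZMod 2) :=
  ∏ e ∈ S, (X e.1 + X e.2)

theorem graphPoly_isHomogeneous {σ : Type*} (S : Finset (σ × σ)) :
    (graphPoly S).IsHomogeneous S.card := by
  have h := IsHomogeneous.prod S (fun e : σ × σ => (X e.1 + X e.2 : MvPolynomial σ (ZMod 2)))
    (fun _ => 1) (fun e _ => (isHomogeneous_X _ _).add (isHomogeneous_X _ _))
  simpa [graphPoly] using h

theorem degree_of_coeff_graphPoly {σ : Type*} {S : Finset (σ × σ)} {d : σ →₀ ℕ}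
    (h : coeff d (graphPoly S) ≠ 0) : d.degree = S.card := by
  have := graphPoly_isHomogeneous S h
  rw [Finsupp.degree_eq_weight_one]
  exact this

theorem support_of_coeff_graphPoly {σ : Type*} {S : Finset (σ × σ)} {d : σ →₀ ℕ}
    (h : coeff d (graphPoly S) ≠ 0) {k : σ} (hk : d k ≠ 0) : ∃ e ∈ S, e.1 = k ∨ e.2 = k := by
  classical
  have h1 : k ∈ (graphPoly S).vars := by
    rw [mem_vars_iff_mem_support]
    exact ⟨d, mem_support_iff.2 h, Finsupp.mem_support_iff.2 hk⟩
  have h2 := vars_prod (fun e : σ × σ => (X e.1 + X e.2 : MvPolynomial σ (ZMod 2))) h1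
  simp only [Finset.mem_biUnion] at h2
  obtain ⟨e, he, hke⟩ := h2
  refine ⟨e, he, ?_⟩
  have := vars_add_subset _ _ hke
  simp only [vars_X, Finset.mem_union, Finset.mem_singleton] at this
  tauto

/-! ### Rows: coefficients of a strip in its two end variables -/

/-- The number of pairs in `E` that contain `k`. -/
def pairDegree (E : Finset (ℕ × ℕ)) (k : ℕ) : ℕ := (E.filter fun e => e.1 = k ∨ e.2 = k).card

/-- For suitable exponents at the points strictly between `i` and `j`, within the truncated degree
bounds of `E`, the coefficients of `graphPoly S` at the monomials of degree `t` in the two end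
variables are the bits of `m`, indexed by the exponent of the variable `i`. -/
def HasRow (E S : Finset (ℕ × ℕ)) (i j t m : ℕ) : Prop :=
  (∀ α, t < α → m.testBit α = false) ∧
  ∃ d : ℕ →₀ ℕ, (∀ k, d k ≠ 0 → i < k ∧ k < j) ∧
    (∀ k, i < k → k < j → d k < min 5 (pairDegree E k)) ∧
    S.card = t + d.degree ∧
    ∀ α β, α + β = t → coeff (d + Finsupp.single i α + Finsupp.single j β) (graphPoly S) =
      if m.testBit α then 1 else 0

/-- The mask of the row obtained by gluing rows `f` (of degree `s`) and `h` with total exponent `e`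
at the common end. -/
def glueMask (s f h e : ℕ) : ℕ := if s ≤ e then f &&& (h >>> (e - s)) else f &&& (h <<< (s - e))

/-- At exponent `α` of the left end, the left factor contributes `s - α` to the common end, which
leaves `e + α - s` for the right factor. -/
theorem testBit_glueMask (s f h e α : ℕ) :
    (glueMask s f h e).testBit α = (f.testBit α && (decide (s ≤ e + α) && h.testBit (e + α - s))) := by
  unfold glueMask
  split_ifs with hs
  · have : s ≤ e + α := by omega
    simp [Nat.testBit_shiftRight, this, show e - s + α = e + α - s by omega]
  · simp only [Nat.testBit_land, Nat.testBit_shiftLeft]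
    congr 2
    · simp only [ge_iff_le, decide_eq_decide]; omega
    · congr 1; omega

theorem HasRow.glue {E S₀ S₁ : Finset (ℕ × ℕ)} {i w j s t f h e : ℕ} (hiw : i < w) (hwj : w < j)
    (hd : Disjoint S₀ S₁) (h₀ : ∀ a ∈ S₀, i ≤ a.1 ∧ a.1 < a.2 ∧ a.2 ≤ w)
    (h₁ : ∀ a ∈ S₁, w ≤ a.1 ∧ a.1 < a.2 ∧ a.2 ≤ j)
    (r₀ : HasRow E S₀ i w s f) (r₁ : HasRow E S₁ w j t h) (he : e < min 5 (pairDegree E w))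
    (hst : e ≤ s + t) : HasRow E (S₀ ∪ S₁) i j (s + t - e) (glueMask s f h e) := by
  classical
  obtain ⟨hf, d₀, hs₀, hc₀, hd₀, hr₀⟩ := r₀
  obtain ⟨hh, d₁, hs₁, hc₁, hd₁, hr₁⟩ := r₁
  refine ⟨?_, d₀ + d₁ + Finsupp.single w e, ?_, ?_, ?_, ?_⟩
  · intro α hα
    rw [testBit_glueMask]
    by_cases h1 : s < α
    · simp [hf α h1]
    · have : t < e + α - s := by omega
      simp [hh _ this]
  · intro k hk
    simp only [Finsupp.add_apply, Finsupp.single_apply] at hk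
    by_cases h1 : d₀ k = 0
    · by_cases h2 : d₁ k = 0
      · have : w = k := by
          by_contra h3
          simp [h1, h2, h3] at hk
        omega
      · have := hs₁ k h2; omega
    · have := hs₀ k h1; omega
  · intro k hik hkj
    simp only [Finsupp.add_apply, Finsupp.single_apply]
    have z₀ : w ≤ k → d₀ k = 0 := fun h3 => by
      by_contra h4; have := hs₀ k h4; omega
    have z₁ : k ≤ w → d₁ k = 0 := fun h3 => by
      by_contra h4; have := hs₁ k h4; omega
    rcases lt_trichotomy k w with h1 | h1 | h1
    · rw [z₁ h1.le, if_neg (by omega)]; exact hc₀ k hik h1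
    · subst h1; rw [z₁ le_rfl, z₀ le_rfl, if_pos rfl]; simpa using he
    · rw [z₀ h1.le, if_neg (by omega)]; simpa using hc₁ k h1 hkj
  · rw [Finset.card_union_of_disjoint hd, hd₀, hd₁]
    simp only [map_add, Finsupp.degree_single]
    omega
  · intro α β hαβ
    have hP : graphPoly (S₀ ∪ S₁) = graphPoly S₀ * graphPoly S₁ := Finset.prod_union hd
    rw [hP, coeff_mul]
    have z₀ : ∀ k, w ≤ k → d₀ k = 0 := fun k h3 => by
      by_contra h4; have := hs₀ k h4; omega
    have z₁ : ∀ k, k ≤ w → d₁ k = 0 := fun k h3 => by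
      by_contra h4; have := hs₁ k h4; omega
    -- Only one splitting of the monomial contributes: the factors share only the variable `w`, and
    -- homogeneity of the left one determines its exponent there.
    have key : ∀ x : (ℕ →₀ ℕ) × (ℕ →₀ ℕ),
        x.1 + x.2 = d₀ + d₁ + Finsupp.single w e + Finsupp.single i α + Finsupp.single j β →
        coeff x.1 (graphPoly S₀) * coeff x.2 (graphPoly S₁) ≠ 0 →
        α ≤ s ∧ s ≤ e + α ∧ x = (d₀ + Finsupp.single i α + Finsupp.single w (s - α),
          d₁ + Finsupp.single w (e + α - s) + Finsupp.single j β) := by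
      rintro ⟨x, y⟩ hxy hne
      simp only at hxy hne
      have hx := left_ne_zero_of_mul hne
      have hy := right_ne_zero_of_mul hne
      have sx : ∀ k, w < k → x k = 0 := fun k hk => by
        by_contra h3
        obtain ⟨a, ha, h4⟩ := support_of_coeff_graphPoly hx h3
        have := h₀ a ha; omega
      have sy : ∀ k, k < w → y k = 0 := fun k hk => by
        by_contra h3
        obtain ⟨a, ha, h4⟩ := support_of_coeff_graphPoly hy h3
        have := h₁ a ha; omega
      have hk : ∀ k, x k + y k = d₀ k + d₁ k + (if w = k then e else 0) + (if i = k then α else 0)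
          + (if j = k then β else 0) := fun k => by
        have := DFunLike.congr_fun hxy k
        simpa [Finsupp.single_apply] using this
      have ex : x = d₀ + Finsupp.single i α + Finsupp.single w (x w) := by
        ext k
        simp only [Finsupp.add_apply, Finsupp.single_apply]
        rcases lt_trichotomy k w with h1 | h1 | h1
        · have := hk k
          rw [sy k h1, z₁ k h1.le, if_neg (by omega), if_neg (show ¬ j = k by omega)] at this
          rw [if_neg (show ¬ w = k by omega)]; omega
        · subst h1; rw [z₀ k le_rfl, if_neg (by omega)]; simp
        · rw [sx k h1, z₀ k h1.le, if_neg (by omega), if_neg (by omega)]; rfl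
      have ey : y = d₁ + Finsupp.single w (y w) + Finsupp.single j β := by
        ext k
        simp only [Finsupp.add_apply, Finsupp.single_apply]
        rcases lt_trichotomy k w with h1 | h1 | h1
        · rw [sy k h1, z₁ k h1.le, if_neg (by omega), if_neg (by omega)]; rfl
        · subst h1; rw [z₁ k le_rfl, if_neg (show ¬ j = k by omega)]; simp
        · have := hk k
          rw [sx k h1, z₀ k h1.le, if_neg (by omega), if_neg (show ¬ i = k by omega)] at this
          rw [if_neg (show ¬ w = k by omega)]; omega
      have dx := degree_of_coeff_graphPoly hx
      rw [ex, hd₀] at dx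
      simp only [map_add, Finsupp.degree_single] at dx
      have hw := hk w
      rw [z₀ w le_rfl, z₁ w le_rfl, if_pos rfl, if_neg (by omega), if_neg (by omega)] at hw
      have e1 : x w = s - α := by omega
      have e2 : y w = e + α - s := by omega
      refine ⟨by omega, by omega, ?_⟩
      rw [Prod.mk.injEq, ← e1, ← e2]
      exact ⟨ex, ey⟩
    rw [testBit_glueMask]
    by_cases hc : α ≤ s ∧ s ≤ e + α
    · rw [Finset.sum_eq_single (d₀ + Finsupp.single i α + Finsupp.single w (s - α),
          d₁ + Finsupp.single w (e + α - s) + Finsupp.single j β)]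
      · simp only
        rw [hr₀ _ _ (by omega), hr₁ _ _ (by omega)]
        by_cases b1 : f.testBit α <;> by_cases b2 : h.testBit (e + α - s) <;> simp [b1, b2, hc.2]
      · intro x hx hne
        by_contra h3
        exact hne (key x (Finset.HasAntidiagonal.mem_antidiagonal.1 hx) h3).2.2
      · intro hn
        exfalso
        apply hn
        rw [Finset.HasAntidiagonal.mem_antidiagonal]
        have : (Finsupp.single w e : ℕ →₀ ℕ) =
            Finsupp.single w (s - α) + Finsupp.single w (e + α - s) := by
          rw [← Finsupp.single_add]; congr 1; omega
        rw [this]; simp only; abel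
    · rw [Finset.sum_eq_zero, if_neg]
      · intro h3
        simp only [Bool.and_eq_true, decide_eq_true_eq] at h3
        apply hc
        refine ⟨?_, h3.2.1⟩
        by_contra h4
        rw [hf α (by omega)] at h3
        simp at h3
      · intro x hx
        by_contra h3
        have := key x (Finset.HasAntidiagonal.mem_antidiagonal.1 hx) h3
        exact hc ⟨this.1, this.2.1⟩

theorem HasRow.insertRoot {E S : Finset (ℕ × ℕ)} {i j t m : ℕ} (hij : i < j) (hn : (i, j) ∉ S)
    (r : HasRow E S i j t m) : HasRow E (insert (i, j) S) i j (t + 1) ((m <<< 1) ^^^ m) := by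
  classical
  obtain ⟨hm, d, hs, hc, hd, hr⟩ := r
  refine ⟨?_, d, hs, hc, ?_, ?_⟩
  · intro α hα
    rw [Nat.testBit_xor, Nat.testBit_shiftLeft, hm α (by omega), hm (α - 1) (by omega)]
    simp
  · rw [Finset.card_insert_of_notMem hn, hd]; omega
  · intro α β hαβ
    have hP : graphPoly (insert (i, j) S) = X i * graphPoly S + X j * graphPoly S := by
      rw [graphPoly, Finset.prod_insert hn, add_mul]; rfl
    rw [hP, coeff_add, coeff_X_mul', coeff_X_mul']
    have di : d i = 0 := by
      by_contra h; have := hs i h; omega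
    have dj : d j = 0 := by
      by_contra h; have := hs j h; omega
    have hi : (d + Finsupp.single i α + Finsupp.single j β) i = α := by
      simp [di, show ¬ j = i by omega]
    have hj : (d + Finsupp.single i α + Finsupp.single j β) j = β := by
      simp [dj, show ¬ i = j by omega]
    have e1 : (if i ∈ (d + Finsupp.single i α + Finsupp.single j β).support then
        coeff (d + Finsupp.single i α + Finsupp.single j β - Finsupp.single i 1) (graphPoly S)
        else 0) = if (decide (1 ≤ α) && m.testBit (α - 1)) then 1 else 0 := by
      simp only [Finsupp.mem_support_iff, hi]
      rcases Nat.eq_zero_or_pos α with h0 | h0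
      · simp [h0]
      · have : d + Finsupp.single i α + Finsupp.single j β - Finsupp.single i 1 =
            d + Finsupp.single i (α - 1) + Finsupp.single j β := by
          ext k
          simp only [Finsupp.tsub_apply, Finsupp.add_apply, Finsupp.single_apply]
          split_ifs <;> omega
        rw [this, hr _ _ (by omega), if_pos (by omega)]
        simp [show 1 ≤ α from h0]
    have e2 : (if j ∈ (d + Finsupp.single i α + Finsupp.single j β).support then
        coeff (d + Finsupp.single i α + Finsupp.single j β - Finsupp.single j 1) (graphPoly S)
        else 0) = if m.testBit α then 1 else 0 := by
      simp only [Finsupp.mem_support_iff, hj]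
      rcases Nat.eq_zero_or_pos β with h0 | h0
      -- Here `α = t + 1`, so the bit is zero by the condition on bits beyond the degree.
      · simp [h0, hm α (by omega)]
      · have : d + Finsupp.single i α + Finsupp.single j β - Finsupp.single j 1 =
            d + Finsupp.single i α + Finsupp.single j (β - 1) := by
          ext k
          simp only [Finsupp.tsub_apply, Finsupp.add_apply, Finsupp.single_apply]
          split_ifs <;> omega
        rw [this, hr _ _ (by omega), if_pos (by omega)]
    rw [e1, e2, Nat.testBit_xor, Nat.testBit_shiftLeft]
    have h2 : (1 : ZMod 2) + 1 = 0 := by decide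
    simp only [ge_iff_le]
    generalize (decide (1 ≤ α) && m.testBit (α - 1)) = x
    generalize m.testBit α = y
    cases x <;> cases y <;> simp [h2]

theorem hasRow_empty (E : Finset (ℕ × ℕ)) (i : ℕ) : HasRow E ∅ i (i + 1) 0 1 := by
  refine ⟨fun α hα => ?_, 0, by simp, fun k _ _ => by omega, by simp, ?_⟩
  · rw [Nat.testBit_one_eq_true_iff_self_eq_zero.not.2 (by omega) |> Bool.eq_false_iff.2]
  · intro α β h
    obtain rfl : α = 0 := by omega
    obtain rfl : β = 0 := by omega
    simp [graphPoly]

/-! ### States of strips and the finite check -/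

/-- `(p, q, rows)` describes `S`, drawn between `i` and `j`: at least `p` pairs of `S` start at `i`,
at least `q` pairs end at `j`, and `S` has all the listed rows `(t, m)`. -/
def Realizes (E S : Finset (ℕ × ℕ)) (i j : ℕ) (z : ℕ × ℕ × List (ℕ × ℕ)) : Prop :=
  z.1 ≤ (S.filter fun e => e.1 = i).card ∧ z.2.1 ≤ (S.filter fun e => e.2 = j).card ∧
    ∀ r ∈ z.2.2, HasRow E S i j r.1 r.2

/-- The rows obtained by gluing a row of `x` and a row of `y` at a common end. -/
def glueRows (x y : ℕ × ℕ × List (ℕ × ℕ)) : List (ℕ × ℕ) :=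
  x.2.2.flatMap fun r => y.2.2.flatMap fun r' =>
    ((List.range (min 5 (x.2.1 + y.1))).filter fun e => e ≤ r.1 + r'.1).map fun e =>
      (r.1 + r'.1 - e, glueMask r.1 r.2 r'.2 e)

/-- The rows obtained by adding the pair of the two ends. -/
def rootRows (x : ℕ × ℕ × List (ℕ × ℕ)) : List (ℕ × ℕ) :=
  x.2.2.map fun r => (r.1 + 1, (r.2 <<< 1) ^^^ r.2)

/-- The description of a single pair. -/
def edgeState : ℕ × ℕ × List (ℕ × ℕ) := (1, 1, [(1, 3)])

/-- Descriptions that suffice for strips with at least three points whose ends form a pair. -/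
def closedStates : List (ℕ × ℕ × List (ℕ × ℕ)) :=
  [(2, 2, [(2, 5), (3, 6)]), (2, 3, [(2, 6), (3, 5)]), (3, 2, [(2, 3), (3, 10), (3, 12)]),
    (3, 3, [(3, 3), (3, 12)])]

/-- Descriptions that suffice for strips with at least three points without the pair of ends. -/
def openStates : List (ℕ × ℕ × List (ℕ × ℕ)) :=
  [(1, 1, [(1, 3), (2, 2)]), (1, 2, [(1, 2), (2, 3)]), (2, 1, [(1, 1), (2, 4), (2, 6)]),
    (2, 2, [(2, 1), (2, 4), (3, 6)]), (2, 2, [(2, 1), (2, 4), (2, 6)]),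
    (3, 2, [(2, 1), (2, 4), (3, 12)])]

/-- Together with `exists_closedState` this is the combinatorial core. The left strip is always cut
along a pair of the dissection, so only the right one can be open. A state keeps lower bounds and a
selection of rows, which is why a few states suffice for all strips. -/
theorem exists_openState : ∀ x ∈ edgeState :: closedStates,
    ∀ y ∈ edgeState :: (closedStates ++ openStates),
    ∃ z ∈ openStates, z.1 ≤ x.1 ∧ z.2.1 ≤ y.2.1 ∧ z.2.2 ⊆ glueRows x y := by
  decide +kernel

theorem exists_closedState : ∀ x ∈ openStates,
    ∃ z ∈ closedStates, z.1 ≤ x.1 + 1 ∧ z.2.1 ≤ x.2.1 + 1 ∧ z.2.2 ⊆ rootRows x := by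
  decide +kernel

/-- This serves the last step: bit 2 of a row of degree 3 stands for the exponents 2 and 1 at the
two ends. -/
theorem closedStates_spec : ∀ z ∈ closedStates,
    2 ≤ z.2.1 ∧ ∃ r ∈ z.2.2, r.1 = 3 ∧ r.2.testBit 2 = true := by
  decide

theorem Realizes.glue {E S₀ S₁ : Finset (ℕ × ℕ)} {i w j : ℕ} (hiw : i < w) (hwj : w < j)
    (hE : S₀ ∪ S₁ ⊆ E) (h₀ : ∀ a ∈ S₀, i ≤ a.1 ∧ a.1 < a.2 ∧ a.2 ≤ w)
    (h₁ : ∀ a ∈ S₁, w ≤ a.1 ∧ a.1 < a.2 ∧ a.2 ≤ j) {x y z : ℕ × ℕ × List (ℕ × ℕ)}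
    (hx : Realizes E S₀ i w x) (hy : Realizes E S₁ w j y) (h1 : z.1 ≤ x.1) (h2 : z.2.1 ≤ y.2.1)
    (h3 : z.2.2 ⊆ glueRows x y) : Realizes E (S₀ ∪ S₁) i j z := by
  have hd : Disjoint S₀ S₁ := Finset.disjoint_left.2 fun a ha hb => by
    have := h₀ a ha; have := h₁ a hb; omega
  refine ⟨h1.trans (hx.1.trans (Finset.card_le_card ?_)),
    h2.trans (hy.2.1.trans (Finset.card_le_card ?_)), fun r hr => ?_⟩
  · exact Finset.filter_subset_filter _ Finset.subset_union_left
  · exact Finset.filter_subset_filter _ Finset.subset_union_right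
  · have := h3 hr
    simp only [glueRows, List.mem_flatMap, List.mem_map, List.mem_filter, List.mem_range,
      decide_eq_true_eq] at this
    obtain ⟨a, ha, b, hb, e, ⟨he, hab⟩, rfl⟩ := this
    refine HasRow.glue hiw hwj hd h₀ h₁ (hx.2.2 a ha) (hy.2.2 b hb) (he.trans_le ?_) hab
    -- The pairs ending at `w` on the left and those starting at `w` on the right are different, so
    -- their numbers add up to a lower bound for the degree of `w`.
    refine min_le_min le_rfl ((add_le_add hx.2.1 hy.1).trans ?_)
    rw [← Finset.card_union_of_disjoint]
    · apply Finset.card_le_card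
      intro a ha
      simp only [Finset.mem_union, Finset.mem_filter] at ha ⊢
      rcases ha with ha | ha
      · exact ⟨hE (Finset.mem_union_left _ ha.1), Or.inr ha.2⟩
      · exact ⟨hE (Finset.mem_union_right _ ha.1), Or.inl ha.2⟩
    · exact hd.mono (Finset.filter_subset _ _) (Finset.filter_subset _ _)

theorem Realizes.insertRoot {E S : Finset (ℕ × ℕ)} {i j : ℕ} (hij : i < j) (hn : (i, j) ∉ S)
    {x z : ℕ × ℕ × List (ℕ × ℕ)} (hx : Realizes E S i j x) (h1 : z.1 ≤ x.1 + 1)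
    (h2 : z.2.1 ≤ x.2.1 + 1) (h3 : z.2.2 ⊆ rootRows x) :
    Realizes E (insert (i, j) S) i j z := by
  refine ⟨?_, ?_, fun r hr => ?_⟩
  · rw [Finset.filter_insert, if_pos rfl, Finset.card_insert_of_notMem (by simp [hn])]
    exact h1.trans (Nat.succ_le_succ hx.1)
  · rw [Finset.filter_insert, if_pos rfl, Finset.card_insert_of_notMem (by simp [hn])]
    exact h2.trans (Nat.succ_le_succ hx.2.1)
  · have := h3 hr
    simp only [rootRows, List.mem_map] at this
    obtain ⟨a, ha, rfl⟩ := this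
    exact (hx.2.2 a ha).insertRoot hij hn

/-! ### Induction over a polygon dissection -/

/-- `E` is the set of edges, listed as increasing pairs, of a polygon with vertices `0, …, n - 1`
together with some pairwise non-crossing diagonals. -/
structure IsDissection (n : ℕ) (E : Finset (ℕ × ℕ)) : Prop where
  lt : ∀ a ∈ E, a.1 < a.2
  lt_card : ∀ a ∈ E, a.2 < n
  side_mem : ∀ i, i + 1 < n → (i, i + 1) ∈ E
  root_mem : (0, n - 1) ∈ E
  noncrossing : ∀ a b c d, a < b → b < c → c < d → (a, c) ∈ E → (b, d) ∉ E

/-- The pairs of `E` between `i` and `j`. -/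
def strip (E : Finset (ℕ × ℕ)) (i j : ℕ) : Finset (ℕ × ℕ) :=
  E.filter fun a => i ≤ a.1 ∧ a.2 ≤ j

theorem IsDissection.strip_spec {n : ℕ} {E : Finset (ℕ × ℕ)} (hE : IsDissection n E) {i j : ℕ} :
    ∀ a ∈ strip E i j, i ≤ a.1 ∧ a.1 < a.2 ∧ a.2 ≤ j := fun a ha => by
  have := Finset.mem_filter.1 ha
  exact ⟨this.2.1, hE.lt a this.1, this.2.2⟩

theorem IsDissection.exists_split {n : ℕ} {E : Finset (ℕ × ℕ)} (hE : IsDissection n E) {i j : ℕ}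
    (hij : i + 2 ≤ j) (hj : j < n) : ∃ w, i < w ∧ w < j ∧ (i, w) ∈ E ∧
      (strip E i j).erase (i, j) = strip E i w ∪ strip E w j := by
  have hex : ∃ w ∈ Finset.Ioo i j, (i, w) ∈ E :=
    ⟨i + 1, by simp; omega, hE.side_mem i (by omega)⟩
  have hne : ((Finset.Ioo i j).filter fun w => (i, w) ∈ E).Nonempty := by
    obtain ⟨w, h1, h2⟩ := hex
    exact ⟨w, Finset.mem_filter.2 ⟨h1, h2⟩⟩
  -- With the largest such `w`, a pair straddling `w` other than the root would either start at `i`,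
  -- against maximality, or cross `(i, w)`.
  obtain ⟨w, hw, hmax⟩ := Finset.exists_max_image _ (fun w => w) hne
  simp only [Finset.mem_filter, Finset.mem_Ioo] at hw hmax
  refine ⟨w, hw.1.1, hw.1.2, hw.2, ?_⟩
  ext ⟨a, b⟩
  simp only [strip, Finset.mem_erase, Finset.mem_filter, Finset.mem_union, ne_eq, Prod.mk.injEq]
  constructor
  · rintro ⟨h1, h2, h3, h4⟩
    have hab := hE.lt _ h2
    simp only at hab
    by_contra h5
    have h6 : a < w ∧ w < b := by
      constructor <;> by_contra h6 <;> apply h5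
      · exact Or.inr ⟨h2, by omega, h4⟩
      · exact Or.inl ⟨h2, h3, by omega⟩
    rcases h3.eq_or_lt with rfl | h7
    · have := hmax b ⟨⟨hab, by omega⟩, h2⟩
      omega
    · exact hE.noncrossing i a w b h7 h6.1 h6.2 hw.2 h2
  · rintro (⟨h1, h2, h3⟩ | ⟨h1, h2, h3⟩)
    · exact ⟨by omega, h1, h2, by omega⟩
    · exact ⟨by omega, h1, by omega, h3⟩

/-- Induction on the length of the strip. Open strips must be carried along because `(w, j)` in the
split need not be a pair of `E`. -/
theorem IsDissection.realizes {n : ℕ} {E : Finset (ℕ × ℕ)} (hE : IsDissection n E) (l : ℕ) :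
    ∀ i j, j < n → i < j → j - i = l →
      (i + 1 = j → Realizes E (strip E i j) i j edgeState) ∧
      (i + 2 ≤ j → (i, j) ∈ E → ∃ z ∈ closedStates, Realizes E (strip E i j) i j z) ∧
      (i + 2 ≤ j → (i, j) ∉ E → ∃ z ∈ openStates, Realizes E (strip E i j) i j z) := by
  induction l using Nat.strong_induction_on with
  | _ l ih =>
  intro i j hj hij hl
  have hopen : i + 2 ≤ j → ∃ z ∈ openStates, Realizes E ((strip E i j).erase (i, j)) i j z := by
    intro h2
    obtain ⟨w, hiw, hwj, hw, hs⟩ := hE.exists_split h2 hj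
    have ha := ih (w - i) (by omega) i w (by omega) hiw rfl
    have hb := ih (j - w) (by omega) w j hj hwj rfl
    have hx : ∃ x ∈ edgeState :: closedStates, Realizes E (strip E i w) i w x := by
      by_cases h : i + 1 = w
      · exact ⟨_, List.mem_cons_self, ha.1 h⟩
      · obtain ⟨x, h3, h4⟩ := ha.2.1 (by omega) hw
        exact ⟨x, List.mem_cons_of_mem _ h3, h4⟩
    have hy : ∃ y ∈ edgeState :: (closedStates ++ openStates), Realizes E (strip E w j) w j y := by
      by_cases h : w + 1 = j
      · exact ⟨_, List.mem_cons_self, hb.1 h⟩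
      · by_cases h5 : (w, j) ∈ E
        · obtain ⟨x, h3, h4⟩ := hb.2.1 (by omega) h5
          exact ⟨x, List.mem_cons_of_mem _ (List.mem_append_left _ h3), h4⟩
        · obtain ⟨x, h3, h4⟩ := hb.2.2 (by omega) h5
          exact ⟨x, List.mem_cons_of_mem _ (List.mem_append_right _ h3), h4⟩
    obtain ⟨x, hx, rx⟩ := hx
    obtain ⟨y, hy, ry⟩ := hy
    obtain ⟨z, hz, h3, h4, h5⟩ := exists_openState x hx y hy
    refine ⟨z, hz, ?_⟩
    rw [hs]
    refine Realizes.glue hiw hwj ?_ hE.strip_spec hE.strip_spec rx ry h3 h4 h5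
    exact Finset.union_subset (Finset.filter_subset _ _) (Finset.filter_subset _ _)
  refine ⟨?_, fun h2 h3 => ?_, fun h2 h3 => ?_⟩
  · rintro rfl
    have : strip E i (i + 1) = insert (i, i + 1) ∅ := by
      ext ⟨a, b⟩
      simp only [strip, Finset.mem_filter, insert_empty_eq, Finset.mem_singleton, Prod.mk.injEq]
      constructor
      · rintro ⟨h1, h2, h3⟩
        have := hE.lt _ h1
        simp only at this
        omega
      · rintro ⟨rfl, rfl⟩
        exact ⟨hE.side_mem _ hj, le_rfl, le_rfl⟩
    rw [this]
    -- A single edge arises by adding the root to the empty strip, whose polynomial is 1.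
    refine Realizes.insertRoot (x := (0, 0, [(0, 1)])) hij (by simp) ⟨by simp, by simp, ?_⟩ le_rfl
      le_rfl (by decide)
    simpa using hasRow_empty E i
  · obtain ⟨x, hx, rx⟩ := hopen h2
    obtain ⟨z, hz, h4, h5, h6⟩ := exists_closedState x hx
    refine ⟨z, hz, ?_⟩
    have := Realizes.insertRoot hij (by simp) rx h4 h5 h6
    rwa [Finset.insert_erase] at this
    simp [strip, h3]
  · have := hopen h2
    rwa [Finset.erase_eq_of_notMem] at this
    simp [strip, h3]

theorem IsDissection.exists_coeff_ne_zero {n : ℕ} {E : Finset (ℕ × ℕ)} (hE : IsDissection n E)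
    (hn : 3 ≤ n) (h0 : 3 ≤ pairDegree E 0) :
    ∃ d : ℕ →₀ ℕ, coeff d (graphPoly E) ≠ 0 ∧ ∀ k < n, d k < min 5 (pairDegree E k) := by
  obtain ⟨z, hz, hr⟩ :=
    (hE.realizes (n - 1) 0 (n - 1) (by omega) (by omega) (by omega)).2.1 (by omega) hE.root_mem
  have hs : strip E 0 (n - 1) = E := by
    refine Finset.filter_true_of_mem fun a ha => ⟨Nat.zero_le _, ?_⟩
    have := hE.lt_card a ha; omega
  rw [hs] at hr
  obtain ⟨h2, ⟨t, m⟩, hrm, ht, hm⟩ := closedStates_spec z hz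
  simp only at ht hm
  subst ht
  obtain ⟨-, d, hd, hc, -, hco⟩ := hr.2.2 _ hrm
  have hlast : 2 ≤ pairDegree E (n - 1) :=
    h2.trans (hr.2.1.trans (Finset.card_le_card (Finset.monotone_filter_right _
      fun a _ ha => Or.inr ha)))
  have d0 : d 0 = 0 := by
    by_contra h; have := hd 0 h; omega
  have dl : d (n - 1) = 0 := by
    by_contra h; have := hd _ h; omega
  refine ⟨d + Finsupp.single 0 2 + Finsupp.single (n - 1) 1, ?_, fun k hk => ?_⟩
  · rw [hco 2 1 rfl, if_pos hm]; exact one_ne_zero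
  · simp only [Finsupp.add_apply, Finsupp.single_apply]
    rcases Nat.eq_zero_or_pos k with rfl | hk0
    · rw [d0, if_pos rfl, if_neg (by omega)]; omega
    · by_cases hk1 : n - 1 = k
      · subst hk1
        rw [dl, if_neg (by omega), if_pos rfl]; omega
      · rw [if_neg (by omega), if_neg hk1]
        exact hc k hk0 (by omega)

/-! ### The Alon–Tarsi criterion modulo two -/

section AlonTarsiModTwo

variable {V : Type*} [DecidableEq V]

theorem sum_single_fst_apply (S : Finset (V × V)) (v : V) :
    (∑ e ∈ S, Finsupp.single e.1 1 : V →₀ ℕ) v = outDeg S v := by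
  simp [outDeg, Finsupp.finsetSum_apply, Finsupp.single_apply]

theorem sum_single_snd_apply (S : Finset (V × V)) (v : V) :
    (∑ e ∈ S, Finsupp.single e.2 1 : V →₀ ℕ) v = inDeg S v := by
  simp [inDeg, Finsupp.finsetSum_apply, Finsupp.single_apply]

theorem coeff_graphPoly (S : Finset (V × V)) (d : V →₀ ℕ) :
    coeff d (graphPoly S) = ∑ T ∈ S.powerset,
      if ∑ e ∈ T, Finsupp.single e.2 1 + ∑ e ∈ S \ T, Finsupp.single e.1 1 = d
      then (1 : ZMod 2) else 0 := by
  have h : graphPoly S = ∏ e ∈ S, (X e.2 + X e.1) :=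
    Finset.prod_congr rfl fun e _ => add_comm _ _
  rw [h, Finset.prod_add, coeff_sum]
  refine Finset.sum_congr rfl fun T _ => ?_
  have hm : ∀ (U : Finset (V × V)) (φ : V × V → V), (∏ e ∈ U, X (φ e) : MvPolynomial V (ZMod 2)) =
      monomial (∑ e ∈ U, Finsupp.single (φ e) 1) 1 := fun U φ => by
    rw [monomial_sum_one]; rfl
  rw [hm, hm, monomial_mul, coeff_monomial, one_mul]

/-- Taking second instead of first ends on `H` changes the exponent of `v` by `inDeg H v - outDeg H
v`. The out-degree sequence is therefore recovered exactly by the Eulerian `H`. -/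
theorem coeff_graphPoly_outDeg (D : Finset (V × V)) :
    coeff (∑ e ∈ D, Finsupp.single e.1 1) (graphPoly D) = ((eulerianSubdigraphs D).card : ZMod 2) := by
  classical
  rw [coeff_graphPoly, eulerianSubdigraphs, Finset.card_filter, Nat.cast_sum]
  refine Finset.sum_congr rfl fun H hH => ?_
  rw [Nat.cast_ite, Nat.cast_one, Nat.cast_zero]
  refine if_congr ?_ rfl rfl
  rw [← Finset.sum_sdiff (Finset.mem_powerset.1 hH), add_comm, add_right_inj, DFunLike.ext_iff]
  refine forall_congr' fun v => ?_
  rw [sum_single_fst_apply, sum_single_snd_apply]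
  exact eq_comm

theorem card_evenEulerian_add_card_oddEulerian (D : Finset (V × V)) :
    (evenEulerian D).card + (oddEulerian D).card = (eulerianSubdigraphs D).card := by
  have h : oddEulerian D = (eulerianSubdigraphs D).filter fun H => ¬ Even H.card :=
    Finset.filter_congr fun H _ => Nat.not_even_iff_odd.symm
  rw [h, evenEulerian, Finset.card_filter_add_card_filter_not]

theorem eulerianDiff_ne_zero_of_coeff {D : Finset (V × V)}
    (h : coeff (∑ e ∈ D, Finsupp.single e.1 1) (graphPoly D) ≠ 0) : eulerianDiff D ≠ 0 := by
  intro h0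
  rw [coeff_graphPoly_outDeg, ← card_evenEulerian_add_card_oddEulerian] at h
  have h1 : (evenEulerian D).card = (oddEulerian D).card := by
    unfold eulerianDiff at h0; omega
  rw [h1, Nat.cast_add, ← two_mul] at h
  exact h (by rw [show (2 : ZMod 2) = 0 from by decide, zero_mul])

/-- The Alon–Tarsi criterion modulo two. -/
theorem isAT_of_coeff_ne_zero {G : SimpleGraph V} {E : Finset (V × V)} (hE : IsOrientation G E)
    {d : V →₀ ℕ} (h : coeff d (graphPoly E) ≠ 0) {f : V → ℕ} (hf : ∀ v, d v < f v) : IsAT G f := by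
  rw [coeff_graphPoly] at h
  -- One term of the expansion shows which pairs to reverse to make `d` the out-degree sequence.
  -- Reversal does not affect the polynomial, since its factors are symmetric.
  obtain ⟨T, hT, hTd⟩ := Finset.exists_ne_zero_of_sum_ne_zero h
  rw [← coeff_graphPoly] at h
  have hTE := Finset.mem_powerset.1 hT
  replace hTd := (ite_ne_right_iff.1 hTd).1
  have hanti : ∀ u v, (u, v) ∈ E → (v, u) ∉ E := fun u v huv hvu =>
    (hE.mem_xor_mem u v (hE.adj_of_mem u v huv)).elim (fun h => h.2 hvu) (fun h => h.2 huv)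
  have hdisj : Disjoint (E \ T) (T.image Prod.swap) := by
    rw [Finset.disjoint_left]
    rintro ⟨u, v⟩ h1 h2
    obtain ⟨⟨a, b⟩, h3, h4⟩ := Finset.mem_image.1 h2
    simp only [Prod.swap_prod_mk, Prod.mk.injEq] at h4
    obtain ⟨rfl, rfl⟩ := h4
    exact hanti _ _ (hTE h3) (Finset.mem_sdiff.1 h1).1
  have hmem : ∀ u v, (u, v) ∈ (E \ T) ∪ T.image Prod.swap ↔
      ((u, v) ∈ E ∧ (u, v) ∉ T) ∨ (v, u) ∈ T := fun u v => by
    simp [Prod.swap_eq_iff_eq_swap]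
  have hd : ∑ e ∈ (E \ T) ∪ T.image Prod.swap, Finsupp.single e.1 1 = d := by
    rw [Finset.sum_union hdisj, Finset.sum_image (fun a _ b _ hab => Prod.swap_injective hab),
      ← hTd, add_comm]
    rfl
  have hP : graphPoly ((E \ T) ∪ T.image Prod.swap) = graphPoly E := by
    unfold graphPoly
    rw [Finset.prod_union hdisj, Finset.prod_image (fun a _ b _ hab => Prod.swap_injective hab),
      ← Finset.prod_sdiff hTE]
    congr 1
    exact Finset.prod_congr rfl fun e _ => add_comm _ _
  refine ⟨(E \ T) ∪ T.image Prod.swap, ⟨⟨fun u v huv => ?_, fun u v huv => ?_⟩, ?_⟩, fun v => ?_⟩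
  · rcases (hmem u v).1 huv with h1 | h1
    · exact hE.adj_of_mem _ _ h1.1
    · exact (hE.adj_of_mem _ _ (hTE h1)).symm
  · rw [hmem, hmem]
    have h1 := @hTE (u, v)
    have h2 := @hTE (v, u)
    rcases hE.mem_xor_mem u v huv with h | h
    · by_cases h3 : (u, v) ∈ T
      · exact Or.inr ⟨Or.inr h3, by tauto⟩
      · exact Or.inl ⟨Or.inl ⟨h.1, h3⟩, by tauto⟩
    · by_cases h3 : (v, u) ∈ T
      · exact Or.inl ⟨Or.inr h3, by tauto⟩
      · exact Or.inr ⟨Or.inl ⟨h.1, h3⟩, by tauto⟩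
  · apply eulerianDiff_ne_zero_of_coeff
    rwa [hd, hP]
  · rw [← sum_single_fst_apply, hd]
    exact hf v

end AlonTarsiModTwo

/-! ### Cycles as periodic sequences -/

/-- `c` runs periodically through a closed walk of `G` without repeated vertices, of length `m`.
For `m = 2` this is an edge traversed back and forth. -/
structure IsPeriodicCycle {V : Type*} (G : SimpleGraph V) (m : ℕ) (c : ℕ → V) : Prop where
  two_le : 2 ≤ m
  adj : ∀ i, G.Adj (c i) (c (i + 1))
  eq_iff : ∀ i j, c i = c j ↔ i ≡ j [MOD m]

namespace IsPeriodicCycle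

variable {V : Type*} {G : SimpleGraph V} {m : ℕ} {c : ℕ → V}

theorem rotate (h : IsPeriodicCycle G m c) (k : ℕ) : IsPeriodicCycle G m fun i => c (i + k) where
  two_le := h.two_le
  adj i := by rw [add_right_comm]; exact h.adj (i + k)
  eq_iff i j := by
    rw [h.eq_iff]
    exact ⟨Nat.ModEq.add_right_cancel' k, Nat.ModEq.add_right k⟩

theorem inj (h : IsPeriodicCycle G m c) {i j : ℕ} (hi : i < m) (hj : j < m) (e : c i = c j) :
    i = j := Nat.ModEq.eq_of_lt_of_lt ((h.eq_iff i j).1 e) hi hj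

theorem apply_mod (h : IsPeriodicCycle G m c) (i : ℕ) : c (i % m) = c i :=
  (h.eq_iff _ _).2 (Nat.mod_modEq i m)

theorem apply_period (h : IsPeriodicCycle G m c) : c m = c 0 :=
  (h.eq_iff _ _).2 (by simp [Nat.ModEq])

theorem exists_lt (h : IsPeriodicCycle G m c) {v : V} (hv : v ∈ Set.range c) : ∃ i < m, c i = v := by
  obtain ⟨i, rfl⟩ := hv
  exact ⟨i % m, Nat.mod_lt _ (by have := h.two_le; omega), h.apply_mod i⟩

end IsPeriodicCycle

/-! ### Winding numbers and the non-planarity of K₅ and K₃,₃ -/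

open Complex

/-- `θ` is the total change of a continuous logarithm of `f` between `0` and `1`. -/
def IsLogIncrement (f : ℝ → ℂ) (θ : ℂ) : Prop :=
  ∃ L : ℝ → ℂ, Continuous L ∧ (∀ t, exp (L t) = f t) ∧ L 1 - L 0 = θ

/-- The exponential map covers the punctured plane, and maps from simply connected spaces lift. -/
theorem exists_continuous_log {A : Type*} [TopologicalSpace A] [SimplyConnectedSpace A]
    [LocallyPathConnectedSpace A] {f : A → ℂ} (hf : Continuous f) (h0 : ∀ a, f a ≠ 0) :
    ∃ L : A → ℂ, Continuous L ∧ ∀ a, exp (L a) = f a := by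
  obtain ⟨a₀⟩ : Nonempty A := inferInstance
  obtain ⟨L, ⟨-, hL⟩, -⟩ := isCoveringMapOn_exp.existsUnique_continuousMap_lifts ⟨f, hf⟩
    (a₀ := a₀) (e₀ := log (f a₀)) (exp_log (h0 a₀)) h0
  exact ⟨L, L.continuous, fun a => congrFun hL a⟩

theorem exists_isLogIncrement {f : ℝ → ℂ} (hf : Continuous f) (h0 : ∀ t, f t ≠ 0) :
    ∃ θ, IsLogIncrement f θ := by
  obtain ⟨L, hL, he⟩ := exists_continuous_log hf h0
  exact ⟨_, L, hL, he, rfl⟩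

/-- The difference is a continuous function with values in the integer multiples of `2πi`. -/
theorem sub_const_of_exp_eq {L M : ℝ → ℂ} (hL : Continuous L) (hM : Continuous M)
    (h : ∀ t, exp (L t) = exp (M t)) (s t : ℝ) : L s - M s = L t - M t := by
  have hn : ∀ t, ∃ n : ℤ, L t - M t = n * (2 * Real.pi * I) := fun t => by
    obtain ⟨n, hn⟩ := exp_eq_exp_iff_exists_int.1 (h t)
    exact ⟨n, by rw [hn]; ring⟩
  choose n hn using hn
  have hc : Continuous fun t => ((n t : ℤ) : ℝ) := by
    have : (fun t => ((n t : ℤ) : ℝ)) = fun t => ((L t - M t) / (2 * Real.pi * I)).re := by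
      funext t
      rw [hn, mul_div_cancel_right₀ _ two_pi_I_ne_zero, intCast_re]
    rw [this]
    fun_prop
  have hc' : Continuous n := by
    rw [Int.isClosedEmbedding_coe_real.isEmbedding.continuous_iff]; exact hc
  have := (PreconnectedSpace.constant inferInstance hc' : n s = n t)
  rw [hn, hn, this]

theorem IsLogIncrement.unique {f : ℝ → ℂ} {θ θ' : ℂ} (h : IsLogIncrement f θ)
    (h' : IsLogIncrement f θ') : θ = θ' := by
  obtain ⟨L, hL, he, rfl⟩ := h
  obtain ⟨M, hM, he', rfl⟩ := h'
  have := sub_const_of_exp_eq hL hM (fun t => (he t).trans (he' t).symm) 1 0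
  linear_combination this

theorem IsLogIncrement.neg {f : ℝ → ℂ} {θ : ℂ} (h : IsLogIncrement f θ) :
    IsLogIncrement (fun t => -f t) θ := by
  obtain ⟨L, hL, he, rfl⟩ := h
  refine ⟨fun t => L t + Real.pi * I, by fun_prop, fun t => ?_, by ring⟩
  rw [exp_add, he, exp_pi_mul_I]; ring

theorem IsLogIncrement.exp_mul {f : ℝ → ℂ} {θ : ℂ} (h : IsLogIncrement f θ) :
    exp θ * f 0 = f 1 := by
  obtain ⟨L, -, he, rfl⟩ := h
  rw [← he, ← he, ← exp_add]; congr 1; ring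

/-- `F` has one logarithm on the whole plane, so both routes along the square from `(0, 0)` to `(1,
1)` have the same increment. -/
theorem isLogIncrement_square {F : ℝ × ℝ → ℂ} (hF : Continuous F) (h0 : ∀ x, F x ≠ 0)
    {a b c d : ℂ} (ha : IsLogIncrement (fun t => F (0, t)) a)
    (hb : IsLogIncrement (fun t => F (1, t)) b) (hc : IsLogIncrement (fun s => F (s, 0)) c)
    (hd : IsLogIncrement (fun s => F (s, 1)) d) : a + d = c + b := by
  obtain ⟨L, hL, he⟩ := exists_continuous_log hF h0
  rw [ha.unique ⟨fun t => L (0, t), by fun_prop, fun t => he _, rfl⟩,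
    hb.unique ⟨fun t => L (1, t), by fun_prop, fun t => he _, rfl⟩,
    hc.unique ⟨fun t => L (t, 0), by fun_prop, fun t => he _, rfl⟩,
    hd.unique ⟨fun t => L (t, 1), by fun_prop, fun t => he _, rfl⟩]
  ring

/-- A choice of logarithm of `p y - p x` that changes by `π i` when `x` and `y` are swapped. -/
noncomputable def orderedLog {ι : Type*} (r : ι → ℕ) (p : ι → ℂ) (x y : ι) : ℂ :=
  if r x < r y then log (p y - p x) else log (p x - p y) + Real.pi * I

theorem exp_orderedLog {ι : Type*} (r : ι → ℕ) {p : ι → ℂ} {x y : ι} (h : p x ≠ p y) :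
    exp (orderedLog r p x y) = p y - p x := by
  unfold orderedLog
  split_ifs
  · exact exp_log (sub_ne_zero.2 h.symm)
  · rw [exp_add, exp_log (sub_ne_zero.2 h), exp_pi_mul_I]; ring

/-- The sign `-1` if `x` precedes `y` and `1` otherwise. -/
def orderSign {ι : Type*} (r : ι → ℕ) (x y : ι) : ℤ := if r x < r y then -1 else 1

theorem orderedLog_sub {ι : Type*} {r : ι → ℕ} (hr : Function.Injective r) (p : ι → ℂ) {x y : ι}
    (h : x ≠ y) :
    orderedLog r p x y - orderedLog r p y x = orderSign r x y * (Real.pi * I) := by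
  have : r x ≠ r y := fun h' => h (hr h')
  unfold orderedLog orderSign
  rcases this.lt_or_gt with h1 | h1
  · rw [if_pos h1, if_neg h1.not_gt, if_pos h1]; push_cast; ring
  · rw [if_neg h1.not_gt, if_pos h1, if_neg h1.not_gt]; push_cast; ring

/-- Comparing the windings of paths around points with the logarithms `orderedLog` of the
differences of their ends gives integers that satisfy one relation for each pair of disjoint
paths. -/
theorem exists_winding {ι : Type*} {r : ι → ℕ} (hr : Function.Injective r) (p : ι → ℂ)
    (γ : ∀ c d, Path (p c) (p d)) : ∃ N : ι → ι → ι → ℤ, ∀ a b c d,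
      Disjoint (Set.range (γ a b)) (Set.range (γ c d)) →
      2 * (N a c d - N b c d - N c a b + N d a b) + orderSign r a d + orderSign r c a +
        orderSign r d b + orderSign r b c = 0 := by
  -- `N a c d` counts the full turns of the path around `p a` in excess of the chosen logarithms; it
  -- is set to 0 if the path meets `p a`.
  have hN : ∀ a c d, ∃ n : ℤ, p a ∉ Set.range (γ c d) →
      IsLogIncrement (fun t => (γ c d).extend t - p a)
        (orderedLog r p a d - orderedLog r p a c + n * (2 * Real.pi * I)) := fun a c d => by
    by_cases h : p a ∈ Set.range (γ c d)
    · exact ⟨0, fun h' => absurd h h'⟩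
    · have hne : ∀ t, (γ c d).extend t - p a ≠ 0 := fun t ht => h (by
        rw [← Path.extend_range]; exact ⟨t, sub_eq_zero.1 ht⟩)
      obtain ⟨θ, hθ⟩ := exists_isLogIncrement
        (f := fun t => (γ c d).extend t - p a) (by fun_prop) hne
      have h1 := hθ.exp_mul
      simp only [Path.extend_zero, Path.extend_one] at h1
      have hac : p a ≠ p c := fun h' => h ⟨0, by rw [h']; exact (γ c d).source⟩
      have had : p a ≠ p d := fun h' => h ⟨1, by rw [h']; exact (γ c d).target⟩
      rw [← exp_orderedLog r hac, ← exp_orderedLog r had, ← exp_add] at h1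
      obtain ⟨n, hn⟩ := exp_eq_exp_iff_exists_int.1 h1
      refine ⟨n, fun _ => ?_⟩
      rwa [show orderedLog r p a d - orderedLog r p a c + n * (2 * Real.pi * I) = θ by
        linear_combination -hn]
  choose N hN using hN
  refine ⟨N, fun a b c d hdis => ?_⟩
  have ma : p a ∈ Set.range (γ a b) := ⟨0, (γ a b).source⟩
  have mb : p b ∈ Set.range (γ a b) := ⟨1, (γ a b).target⟩
  have mc : p c ∈ Set.range (γ c d) := ⟨0, (γ c d).source⟩
  have md : p d ∈ Set.range (γ c d) := ⟨1, (γ c d).target⟩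
  have hl := Set.disjoint_left.1 hdis
  have hne : ∀ {x y : ι}, p x ∈ Set.range (γ a b) → p y ∈ Set.range (γ c d) → x ≠ y := by
    rintro x _ h1 h2 rfl
    exact hl h1 h2
  -- The difference of the two disjoint paths never vanishes on the square, and on each side one of
  -- the paths stays at an end. On two sides the difference appears negated, which leaves the
  -- increment unchanged.
  have key := isLogIncrement_square
    (F := fun x => (γ c d).extend x.2 - (γ a b).extend x.1) (by fun_prop)
    (fun x h => hl (a := (γ a b).extend x.1) (by rw [← Path.extend_range]; exact ⟨_, rfl⟩)
      (by rw [← Path.extend_range]; exact ⟨x.2, sub_eq_zero.1 h⟩))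
    (by simpa using hN a c d (hl ma)) (by simpa using hN b c d (hl mb))
    (by simpa using (hN c a b (fun h => hl h mc)).neg)
    (by simpa using (hN d a b (fun h => hl h md)).neg)
  have e1 := orderedLog_sub hr p (hne ma md)
  have e2 := orderedLog_sub hr p (hne ma mc).symm
  have e3 := orderedLog_sub hr p (hne mb md).symm
  have e4 := orderedLog_sub hr p (hne mb mc)
  have h2 : ((2 * (N a c d - N b c d - N c a b + N d a b) + orderSign r a d + orderSign r c a +
        orderSign r d b + orderSign r b c : ℤ) : ℂ) * (Real.pi * I) = 0 := by
    push_cast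
    linear_combination key - e1 - e2 - e3 - e4
  have h3 : (Real.pi * I : ℂ) ≠ 0 := by simp [Real.pi_ne_zero]
  exact_mod_cast (mul_eq_zero.1 h2).resolve_right h3

/-- A complete graph on five vertices cannot be drawn in the plane so that the drawings of any two
edges without a common end are disjoint. -/
theorem not_complete_five_joinedIn (p : Fin 5 → ℂ) (K : Fin 5 → Fin 5 → Set ℂ)
    (hK : ∀ a b, a < b → JoinedIn (K a b) (p a) (p b))
    (hd : ∀ a b c d, a < b → c < d → a < c → b ≠ c → b ≠ d → Disjoint (K a b) (K c d)) : False := by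
  have hγ : ∀ a b, ∃ γ : Path (p a) (p b), a < b → Set.range γ ⊆ K a b := fun a b => by
    by_cases h : a < b
    · exact ⟨(hK a b h).somePath, fun _ => by
        rintro _ ⟨t, rfl⟩; exact (hK a b h).somePath_mem t⟩
    · exact ⟨(PathConnectedSpace.joined (p a) (p b)).somePath, fun h' => absurd h' h⟩
  choose γ hγ using hγ
  obtain ⟨N, hN⟩ := exists_winding (r := fun x : Fin 5 => (x : ℕ)) Fin.val_injective p γ
  have h : ∀ a b c d : Fin 5, a < b → c < d → a < c → b ≠ c → b ≠ d → _ :=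
    fun a b c d h1 h2 h3 h4 h5 => hN a b c d ((hd a b c d h1 h2 h3 h4 h5).mono (hγ a b h1) (hγ c d h2))
  have i1 := h 0 1 2 3 (by decide) (by decide) (by decide) (by decide) (by decide)
  have i2 := h 0 2 1 3 (by decide) (by decide) (by decide) (by decide) (by decide)
  have i3 := h 0 3 1 2 (by decide) (by decide) (by decide) (by decide) (by decide)
  have i4 := h 0 1 2 4 (by decide) (by decide) (by decide) (by decide) (by decide)
  have i5 := h 0 2 1 4 (by decide) (by decide) (by decide) (by decide) (by decide)
  have i6 := h 0 4 1 2 (by decide) (by decide) (by decide) (by decide) (by decide)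
  have i7 := h 0 1 3 4 (by decide) (by decide) (by decide) (by decide) (by decide)
  have i8 := h 0 3 1 4 (by decide) (by decide) (by decide) (by decide) (by decide)
  have i9 := h 0 4 1 3 (by decide) (by decide) (by decide) (by decide) (by decide)
  have j1 := h 0 2 3 4 (by decide) (by decide) (by decide) (by decide) (by decide)
  have j2 := h 0 3 2 4 (by decide) (by decide) (by decide) (by decide) (by decide)
  have j3 := h 0 4 2 3 (by decide) (by decide) (by decide) (by decide) (by decide)
  have j4 := h 1 2 3 4 (by decide) (by decide) (by decide) (by decide) (by decide)
  have j5 := h 1 3 2 4 (by decide) (by decide) (by decide) (by decide) (by decide)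
  have j6 := h 1 4 2 3 (by decide) (by decide) (by decide) (by decide) (by decide)
  -- The signs add up to 2 if the ends of the two edges alternate in the order of the vertices, and
  -- to 0 otherwise. Five of the fifteen pairs alternate, whereas each winding number occurs in
  -- exactly two relations. Halving and adding the relations is contradictory modulo two.
  simp [orderSign] at i1 i2 i3 i4 i5 i6 i7 i8 i9 j1 j2 j3 j4 j5 j6
  omega

/-- A complete bipartite graph with two classes of three vertices cannot be drawn in the plane so
that the drawings of any two edges without a common end are disjoint. -/
theorem not_complete_bipartite_three_joinedIn (p q : Fin 3 → ℂ) (K : Fin 3 → Fin 3 → Set ℂ)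
    (hK : ∀ i j, JoinedIn (K i j) (p i) (q j))
    (hd : ∀ i j i' j', i ≠ i' → j ≠ j' → Disjoint (K i j) (K i' j')) : False := by
  have hγ : ∀ a b : Fin 3 ⊕ Fin 3, ∃ γ : Path (Sum.elim p q a) (Sum.elim p q b),
      ∀ i j, a = Sum.inl i → b = Sum.inr j → Set.range γ ⊆ K i j := by
    rintro (i | i) (j | j)
    · exact ⟨(PathConnectedSpace.joined _ _).somePath, by simp⟩
    · refine ⟨(hK i j).somePath, ?_⟩
      rintro i' j' h1 h2
      obtain rfl := Sum.inl_injective h1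
      obtain rfl := Sum.inr_injective h2
      rintro _ ⟨t, rfl⟩
      exact (hK i j).somePath_mem t
    · exact ⟨(PathConnectedSpace.joined _ _).somePath, by simp⟩
    · exact ⟨(PathConnectedSpace.joined _ _).somePath, by simp⟩
  choose γ hγ using hγ
  have hr : Function.Injective (Sum.elim (fun i => (i : ℕ)) (fun j => 3 + (j : ℕ)) :
      Fin 3 ⊕ Fin 3 → ℕ) := by decide
  obtain ⟨N, hN⟩ := exists_winding hr _ γ
  have h : ∀ i j i' j' : Fin 3, i < i' → j ≠ j' → _ := fun i j i' j' h1 h2 =>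
    hN (.inl i) (.inr j) (.inl i') (.inr j') ((hd i j i' j' h1.ne h2).mono
      (hγ _ _ i j rfl rfl) (hγ _ _ i' j' rfl rfl))
  have h' : ∀ i i' : Fin 3, i < i' → _ := fun i i' hi =>
    (⟨h i 0 i' 1 hi (by decide), h i 0 i' 2 hi (by decide), h i 1 i' 0 hi (by decide),
      h i 1 i' 2 hi (by decide), h i 2 i' 0 hi (by decide), h i 2 i' 1 hi (by decide)⟩ :
      _ ∧ _ ∧ _ ∧ _ ∧ _ ∧ _)
  have i1 := h' 0 1 (by decide)
  have i2 := h' 0 2 (by decide)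
  have i3 := h' 1 2 (by decide)
  -- The same parity count: nine of the eighteen pairs alternate, and each winding number occurs
  -- twice.
  simp [orderSign] at i1 i2 i3
  omega

/-! ### Subdivisions excluded by outerplanarity -/

/-- There is a walk from `u` to `v` that stays in `S`. -/
def LinkedIn {V : Type*} (G : SimpleGraph V) (S : Set V) (u v : V) : Prop :=
  ∃ p : G.Walk u v, ∀ x ∈ p.support, x ∈ S

namespace LinkedIn

variable {V : Type*} {G : SimpleGraph V} {S T : Set V} {u v w : V}

theorem refl (h : u ∈ S) : LinkedIn G S u u := ⟨.nil, by simpa using h⟩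

theorem of_adj (h : G.Adj u v) (hu : u ∈ S) (hv : v ∈ S) : LinkedIn G S u v :=
  ⟨.cons h .nil, by simp [hu, hv]⟩

theorem symm (h : LinkedIn G S u v) : LinkedIn G S v u := by
  obtain ⟨p, hp⟩ := h
  exact ⟨p.reverse, by simpa using hp⟩

theorem trans (h : LinkedIn G S u v) (h' : LinkedIn G S v w) : LinkedIn G S u w := by
  obtain ⟨p, hp⟩ := h
  obtain ⟨q, hq⟩ := h'
  refine ⟨p.append q, fun x hx => ?_⟩
  rcases (SimpleGraph.Walk.mem_support_append_iff _ _).1 hx with hx | hx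
  · exact hp x hx
  · exact hq x hx

theorem mono (h : LinkedIn G S u v) (hST : S ⊆ T) : LinkedIn G T u v := by
  obtain ⟨p, hp⟩ := h
  exact ⟨p, fun x hx => hST (hp x hx)⟩

theorem right_mem (h : LinkedIn G S u v) : v ∈ S := by
  obtain ⟨p, hp⟩ := h
  exact hp v p.end_mem_support

theorem left_mem (h : LinkedIn G S u v) : u ∈ S := h.symm.right_mem

end LinkedIn

namespace PlaneEmbedding

variable {V : Type*} {G : SimpleGraph V} (Γ : PlaneEmbedding G)

/-- The part of the drawing that represents the subgraph induced by `S`. -/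
def region (S : Set V) : Set Plane :=
  Γ.point '' S ∪ ⋃ e ∈ {e | e ∈ G.edgeSet ∧ ∀ v ∈ e, v ∈ S}, Γ.arc e

theorem region_mono {S T : Set V} (h : S ⊆ T) : Γ.region S ⊆ Γ.region T :=
  Set.union_subset_union (Set.image_mono h)
    (Set.biUnion_subset_biUnion_left fun _ he => ⟨he.1, fun v hv => h (he.2 v hv)⟩)

theorem region_subset_carrier (S : Set V) : Γ.region S ⊆ Γ.carrier :=
  Set.union_subset_union (Set.image_subset_range _ _)
    (Set.biUnion_subset_biUnion_left fun _ he => he.1)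

theorem carrier_eq_region : Γ.carrier = Γ.region Set.univ := by
  simp [carrier, region]

theorem mem_of_point_mem_region {S : Set V} {v : V} (h : Γ.point v ∈ Γ.region S) : v ∈ S := by
  rcases h with ⟨u, hu, h⟩ | h
  · rwa [← Γ.point_injective h]
  · simp only [Set.mem_ofPred_eq, Set.mem_iUnion] at h
    obtain ⟨e, he, h⟩ := h
    exact he.2 v (Γ.vertex_mem_arc e he.1 v h)

theorem disjoint_region {S T : Set V} (h : Disjoint S T) : Disjoint (Γ.region S) (Γ.region T) := by
  rw [Set.disjoint_left] at h ⊢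
  intro x hS hT
  rcases hS with ⟨u, hu, rfl⟩ | hS
  · exact h hu (Γ.mem_of_point_mem_region hT)
  rcases hT with ⟨u, hu, rfl⟩ | hT
  · exact h (Γ.mem_of_point_mem_region (Or.inr hS)) hu
  simp only [Set.mem_ofPred_eq, Set.mem_iUnion] at hS hT
  obtain ⟨e, he, hxe⟩ := hS
  obtain ⟨f, hf, hxf⟩ := hT
  have hne : e ≠ f := by
    rintro rfl
    obtain ⟨v, hv⟩ : ∃ v, v ∈ e := by
      induction e using Sym2.ind with | _ a b => exact ⟨a, by simp⟩
    exact h (he.2 v hv) (hf.2 v hv)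
  obtain ⟨v, ⟨hve, hvf⟩, -⟩ := Γ.arc_inter e he.1 f hf.1 hne ⟨hxe, hxf⟩
  exact h (he.2 v hve) (hf.2 v hvf)

theorem isClosed_region [Finite V] (S : Set V) : IsClosed (Γ.region S) := by
  refine (Set.toFinite _).isClosed.union (Set.Finite.isClosed_biUnion (Set.toFinite _) ?_)
  rintro e ⟨he, -⟩
  induction e using Sym2.ind with
  | _ a b =>
    obtain ⟨γ, -, hγ⟩ := Γ.arc_simple a b he
    rw [← hγ]
    exact (isCompact_range γ.continuous).isClosed

theorem joinedIn_region {S : Set V} {u v : V} (h : LinkedIn G S u v) :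
    JoinedIn (Γ.region S) (Γ.point u) (Γ.point v) := by
  obtain ⟨p, hp⟩ := h
  induction p with
  | nil => exact JoinedIn.refl (Or.inl ⟨_, hp _ (by simp), rfl⟩)
  | @cons a b c hab p ih =>
    refine JoinedIn.trans ?_ (ih fun x hx => hp x (by simp [hx]))
    obtain ⟨γ, -, hγ⟩ := Γ.arc_simple a b hab
    refine ⟨γ, fun t => Or.inr ?_⟩
    simp only [Set.mem_ofPred_eq, Set.mem_iUnion]
    refine ⟨s(a, b), ⟨hab, ?_⟩, hγ ▸ ⟨t, rfl⟩⟩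
    intro v hv
    rcases Sym2.mem_iff.1 hv with rfl | rfl
    · exact hp _ (by simp)
    · exact hp _ (by simp)

/-- A point of a face whose closure contains all vertices can be joined to each vertex without
meeting the part of the drawing that avoids this vertex. -/
theorem exists_apex [Finite V] {F : Set Plane} (hF : Γ.IsFace F)
    (hv : ∀ v, Γ.point v ∈ closure F) : ∃ (z : Plane) (A : V → Set Plane),
      ∀ v, JoinedIn (A v) z (Γ.point v) ∧ ∀ S, v ∉ S → Disjoint (A v) (Γ.region S) := by
  obtain ⟨z, hz, rfl⟩ := hF
  have hopen : IsOpen (connectedComponentIn Γ.carrierᶜ z) := by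
    refine IsOpen.connectedComponentIn ?_
    rw [carrier_eq_region]
    exact (Γ.isClosed_region _).isOpen_compl
  have hpath := hopen.isConnected_iff_isPathConnected.1 (isConnected_connectedComponentIn_iff.2 hz)
  have hball : ∀ v, ∃ r > 0, Disjoint (Metric.ball (Γ.point v) r) (Γ.region {v}ᶜ) := fun v => by
    have h1 : Γ.point v ∈ (Γ.region {v}ᶜ)ᶜ := fun h => Γ.mem_of_point_mem_region h rfl
    obtain ⟨r, hr, h2⟩ := Metric.isOpen_iff.1 (Γ.isClosed_region {v}ᶜ).isOpen_compl _ h1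
    exact ⟨r, hr, Set.disjoint_left.2 fun x hx => h2 hx⟩
  choose r hr hball using hball
  -- The connection runs inside the face until it is near `v` and then through a small ball.
  -- Connections to different vertices may overlap, which is harmless because such edges share the
  -- end `z`.
  refine ⟨z, fun v => connectedComponentIn Γ.carrierᶜ z ∪ Metric.ball (Γ.point v) (r v),
    fun v => ⟨?_, fun S hS => ?_⟩⟩
  · obtain ⟨y, hy, hyv⟩ := Metric.mem_closure_iff.1 (hv v) (r v) (hr v)
    refine ((hpath.joinedIn z (mem_connectedComponentIn hz) y hy).mono
      Set.subset_union_left).trans (JoinedIn.mono ?_ Set.subset_union_right)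
    exact ((convex_ball _ _).isPathConnected ⟨_, Metric.mem_ball_self (hr v)⟩).joinedIn _
      (by rwa [Metric.mem_ball, dist_comm]) _ (Metric.mem_ball_self (hr v))
  · rw [Set.disjoint_union_left]
    refine ⟨Set.disjoint_left.2 fun x hx hx' => ?_, (hball v).mono_right (Γ.region_mono ?_)⟩
    · exact connectedComponentIn_subset _ _ hx (Γ.region_subset_carrier S hx')
    · rintro u hu rfl
      exact hS hu

end PlaneEmbedding

/-- A fixed isometry from the Euclidean plane to the complex numbers. -/
noncomputable def planeToComplex : Plane ≃ₗᵢ[ℝ] ℂ := Complex.orthonormalBasisOneI.repr.symm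

theorem JoinedIn.planeToComplex {S : Set Plane} {x y : Plane} (h : JoinedIn S x y) :
    JoinedIn (planeToComplex '' S) (planeToComplex x) (planeToComplex y) :=
  h.map (LinearIsometryEquiv.continuous _)

theorem Disjoint.planeToComplex {S T : Set Plane} (h : Disjoint S T) :
    Disjoint (planeToComplex '' S) (planeToComplex '' T) :=
  Set.disjoint_image_of_injective (LinearIsometryEquiv.injective _) h

namespace IsOuterplanar

variable {V : Type*} [Finite V] {G : SimpleGraph V}

theorem exists_apex (h : IsOuterplanar G) : ∃ (Γ : PlaneEmbedding G) (z : Plane)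
    (A : V → Set Plane),
      ∀ v, JoinedIn (A v) z (Γ.point v) ∧ ∀ S, v ∉ S → Disjoint (A v) (Γ.region S) := by
  obtain ⟨Γ, F, hF, hv⟩ := h
  exact ⟨Γ, Γ.exists_apex hF.1 fun v => frontier_subset_closure (hv v)⟩

/-- An outerplanar graph has no subdivision of the complete bipartite graph on two and three
vertices. -/
theorem not_bipartite_two_three (h : IsOuterplanar G) (s : Fin 2 → V) (x : Fin 3 → V)
    (S : Fin 2 → Fin 3 → Set V) (hl : ∀ i j, LinkedIn G (S i j) (s i) (x j))
    (hd : ∀ i j i' j', i ≠ i' → j ≠ j' → Disjoint (S i j) (S i' j')) : False := by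
  obtain ⟨Γ, z, A, hA⟩ := h.exists_apex
  have hx : ∀ i j j', j ≠ j' → x j ∉ S i j' := fun i j j' hj hx => by
    have hi : i + 1 ≠ i := by fin_cases i <;> decide
    exact Set.disjoint_left.1 (hd (i + 1) j i j' hi hj) (hl _ j).right_mem hx
  -- The point `z` of the outer face becomes the third vertex of the class of the `s i`.
  refine not_complete_bipartite_three_joinedIn
    (Fin.cons (planeToComplex z) fun i => planeToComplex (Γ.point (s i)))
    (fun j => planeToComplex (Γ.point (x j)))
    (fun i j => planeToComplex '' (Fin.cases (A (x j)) (fun i => Γ.region (S i j)) i)) ?_ ?_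
  · intro i j
    refine Fin.cases ?_ (fun i => ?_) i
    · exact (hA (x j)).1.planeToComplex
    · exact (Γ.joinedIn_region (hl i j)).planeToComplex
  · intro i j i' j' hi hj
    apply Disjoint.planeToComplex
    revert hi
    refine Fin.cases ?_ (fun i => ?_) i <;> refine Fin.cases ?_ (fun i' => ?_) i' <;> intro hi
    · exact absurd rfl hi
    · exact (hA (x j)).2 _ (hx i' j j' hj)
    · exact ((hA (x j')).2 _ (hx i j' j hj.symm)).symm
    · exact Γ.disjoint_region (hd i j i' j' (fun h => hi (by rw [h])) hj)

/-- An outerplanar graph has no subdivision of the complete graph on four vertices. -/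
theorem not_complete_four (h : IsOuterplanar G) (x : Fin 4 → V)
    (S : Fin 4 → Fin 4 → Set V) (hl : ∀ a b, a < b → LinkedIn G (S a b) (x a) (x b))
    (hx : ∀ a b c, a < b → c ≠ a → c ≠ b → x c ∉ S a b)
    (hd : ∀ a b c d, a < b → c < d → a < c → b ≠ c → b ≠ d → Disjoint (S a b) (S c d)) :
    False := by
  obtain ⟨Γ, z, A, hA⟩ := h.exists_apex
  -- The point `z` becomes vertex 0. The empty sets fill positions with `a ≥ b`, which are never
  -- used.
  refine not_complete_five_joinedIn
    (Fin.cons (planeToComplex z) fun a => planeToComplex (Γ.point (x a)))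
    (fun a b => planeToComplex '' (Fin.cases (Fin.cases ∅ (fun b => A (x b)) b)
      (fun a => Fin.cases ∅ (fun b => Γ.region (S a b)) b) a)) ?_ ?_
  · intro a b
    refine Fin.cases ?_ (fun a => ?_) a <;> refine Fin.cases ?_ (fun b => ?_) b <;> intro hab
    · exact absurd hab (lt_irrefl _)
    · exact (hA (x b)).1.planeToComplex
    · exact absurd hab (Fin.not_lt_zero _)
    · exact (Γ.joinedIn_region (hl a b (Fin.succ_lt_succ_iff.1 hab))).planeToComplex
  · intro a b c d hab hcd hac hbc hbd
    apply Disjoint.planeToComplex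
    obtain ⟨b, rfl⟩ := Fin.exists_succ_eq_of_ne_zero (Fin.ne_zero_of_lt hab)
    obtain ⟨c, rfl⟩ := Fin.exists_succ_eq_of_ne_zero (Fin.ne_zero_of_lt hac)
    obtain ⟨d, rfl⟩ := Fin.exists_succ_eq_of_ne_zero (Fin.ne_zero_of_lt hcd)
    replace hbc : b ≠ c := fun h => hbc (by rw [h])
    replace hbd : b ≠ d := fun h => hbd (by rw [h])
    replace hcd := Fin.succ_lt_succ_iff.1 hcd
    revert hab hac
    refine Fin.cases ?_ (fun a => ?_) a <;> intro hab hac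
    · exact (hA (x b)).2 _ (hx c d b hcd hbc hbd)
    · exact Γ.disjoint_region (hd a b c d (Fin.succ_lt_succ_iff.1 hab) hcd
        (Fin.succ_lt_succ_iff.1 hac) hbc hbd)

end IsOuterplanar

/-! ### Hamiltonian cycles and non-crossing chords -/

namespace IsPeriodicCycle

variable {V : Type*} {G : SimpleGraph V} {m : ℕ} {c : ℕ → V}

theorem of_adj {a b : V} (h : G.Adj a b) :
    IsPeriodicCycle G 2 fun i => if i % 2 = 0 then a else b where
  two_le := le_rfl
  adj i := by
    rcases Nat.mod_two_eq_zero_or_one i with hi | hi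
    · simpa [hi, Nat.add_mod] using h
    · simpa [hi, Nat.add_mod] using h.symm
  eq_iff i j := by
    have := h.ne
    have := h.ne'
    unfold Nat.ModEq
    rcases Nat.mod_two_eq_zero_or_one i with hi | hi <;>
      rcases Nat.mod_two_eq_zero_or_one j with hj | hj <;> simp [*]

theorem le_card [Fintype V] (h : IsPeriodicCycle G m c) : m ≤ Fintype.card V := by
  simpa using Fintype.card_le_of_injective (fun i : Fin m => c i)
    fun i j hij => Fin.ext (h.inj i.2 j.2 hij)

theorem linkedIn (h : IsPeriodicCycle G m c) {i j : ℕ} (hij : i ≤ j) {S : Set V}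
    (hS : ∀ k, i ≤ k → k ≤ j → c k ∈ S) : LinkedIn G S (c i) (c j) := by
  induction j, hij using Nat.le_induction with
  | base => exact .refl (hS i le_rfl le_rfl)
  | succ j hij ih =>
    exact (ih fun k h1 h2 => hS k h1 (by omega)).trans
      (.of_adj (h.adj j) (hS j hij (by omega)) (hS _ (by omega) le_rfl))

theorem range_rotate (h : IsPeriodicCycle G m c) (i : ℕ) :
    Set.range (fun x => c (x + i)) = Set.range c := by
  refine Set.Subset.antisymm (by rintro _ ⟨x, rfl⟩; exact ⟨_, rfl⟩) ?_
  rintro _ ⟨x, rfl⟩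
  refine ⟨x + (m - 1) * i, (h.eq_iff _ _).2 ?_⟩
  obtain ⟨l, rfl⟩ : ∃ l, m = l + 1 := ⟨m - 1, by have := h.two_le; omega⟩
  rw [Nat.add_sub_cancel, show x + l * i + i = x + (l + 1) * i by ring]
  simp [Nat.ModEq]

theorem exists_succ_eq (h : IsPeriodicCycle G m c) {v : V} (hv : v ∈ Set.range c) :
    ∃ i, c (i + 1) = v := by
  obtain ⟨i, rfl⟩ := hv
  have := h.two_le
  refine ⟨i + (m - 1), (h.eq_iff _ _).2 ?_⟩
  rw [show i + (m - 1) + 1 = i + m by omega]; simp [Nat.ModEq]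

theorem apply_ne_apply_add_two (h : IsPeriodicCycle G m c) (hm : 3 ≤ m) (i : ℕ) :
    c i ≠ c (i + 2) := fun e => by
  have h1 := (h.eq_iff _ _).1 e
  rw [Nat.ModEq.comm, Nat.add_modEq_left_iff] at h1
  have := Nat.le_of_dvd (by omega) h1
  omega

theorem disjoint_image (h : IsPeriodicCycle G m c) {I J : Set ℕ} (hI : ∀ i ∈ I, i < m)
    (hJ : ∀ i ∈ J, i < m) (hd : ∀ i ∈ I, i ∉ J) : Disjoint (c '' I) (c '' J) := by
  rw [Set.disjoint_left]
  rintro _ ⟨i, hi, rfl⟩ ⟨j, hj, hij⟩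
  exact hd i hi (h.inj (hI i hi) (hJ j hj) hij.symm ▸ hj)

theorem adj_pred_zero (h : IsPeriodicCycle G m c) : G.Adj (c (m - 1)) (c 0) := by
  have h1 := h.adj (m - 1)
  have := h.two_le
  rwa [show m - 1 + 1 = m by omega, h.apply_period] at h1

/-- Replacing an edge of the cycle by a path through new vertices gives a longer cycle. -/
theorem exists_longer (h : IsPeriodicCycle G m c) {k k' : V} (hk : G.Adj (c 0) k)
    (hk' : G.Adj (c 1) k') (hl : LinkedIn G (Set.range c)ᶜ k k') :
    ∃ m' c', m < m' ∧ IsPeriodicCycle G m' c' := by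
  classical
  obtain ⟨p, hp⟩ := hl
  obtain ⟨q, hq, hqC⟩ : ∃ q : G.Walk k k', q.IsPath ∧ ∀ x ∈ q.support, x ∈ (Set.range c)ᶜ :=
    ⟨p.bypass, p.bypass_isPath, fun x hx => hp x (p.support_bypass_subset_support hx)⟩
  have h2 := h.two_le
  have hqm : ∀ i, q.getVert i ∉ Set.range c := fun i => hqC _ (q.getVert_mem_support i)
  -- The new cycle runs through `c 1, …, c m = c 0` and then through the `q.length + 1` vertices of
  -- the path from `k` to `k'`.
  set n := m + q.length + 1 with hn
  refine ⟨n, fun i => if i % n < m then c (i % n + 1) else q.getVert (i % n - m), by omega, by omega,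
    fun i => ?_, fun i j => ?_⟩
  · have hr : i % n < n := Nat.mod_lt _ (by omega)
    rw [Nat.add_mod, Nat.mod_eq_of_lt (show 1 < n by omega)]
    generalize i % n = r at hr
    by_cases h3 : r + 1 = n
    · rw [h3, Nat.mod_self, if_neg (by omega), if_pos (by omega),
        show r - m = q.length by omega, q.getVert_length]
      exact hk'.symm
    · rw [Nat.mod_eq_of_lt (show r + 1 < n by omega)]
      by_cases h4 : r + 1 < m
      · rw [if_pos (by omega), if_pos h4]; exact h.adj _
      · rw [if_neg h4]
        by_cases h5 : r < m
        · rw [if_pos h5, show r + 1 = m by omega, h.apply_period, Nat.sub_self, q.getVert_zero]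
          exact hk
        · rw [if_neg h5, show r + 1 - m = r - m + 1 by omega]
          exact q.adj_getVert_succ (by omega)
  · have hr : i % n < n := Nat.mod_lt _ (by omega)
    have hs : j % n < n := Nat.mod_lt _ (by omega)
    unfold Nat.ModEq
    generalize i % n = r at hr
    generalize j % n = s at hs
    constructor
    · intro e
      split_ifs at e with h3 h4 h4
      · have := Nat.ModEq.add_right_cancel' 1 ((h.eq_iff _ _).1 e)
        exact Nat.ModEq.eq_of_lt_of_lt this h3 h4
      · exact absurd ⟨_, e⟩ (hqm _)
      · exact absurd ⟨_, e.symm⟩ (hqm _)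
      · have := hq.getVert_injOn (show r - m ≤ q.length by omega)
          (show s - m ≤ q.length by omega) e
        omega
    · rintro rfl; rfl

/-- A vertex outside the cycle is linked, outside the cycle, to a neighbour of a vertex of the cycle
other than `r`, unless `r` is a cut vertex. -/
theorem exists_attachment (h : IsPeriodicCycle G m c) {r w : V}
    (hr : (G.induce {u : V | u ≠ r}).Connected) (hrc : r ∈ Set.range c) (hw : w ∉ Set.range c) :
    ∃ s ∈ Set.range c, s ≠ r ∧ ∃ k, G.Adj s k ∧ LinkedIn G (Set.range c)ᶜ w k := by
  have h01 : c 0 ≠ c 1 := (h.adj 0).ne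
  obtain ⟨b, hb, hbr⟩ : ∃ b ∈ Set.range c, b ≠ r := by
    by_cases h0 : c 0 = r
    · exact ⟨c 1, ⟨1, rfl⟩, h0 ▸ h01.symm⟩
    · exact ⟨c 0, ⟨0, rfl⟩, h0⟩
  have hwr : w ≠ r := fun e => hw (e ▸ hrc)
  obtain ⟨p⟩ := hr.preconnected ⟨w, hwr⟩ ⟨b, hbr⟩
  -- Follow a walk that avoids `r` from `w` towards the cycle: its first vertex on the cycle is the
  -- desired `s`.
  have key : ∀ (x y : {u : V | u ≠ r}), (G.induce {u : V | u ≠ r}).Walk x y →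
      y.1 ∈ Set.range c → LinkedIn G (Set.range c)ᶜ w x →
      ∃ s ∈ Set.range c, s ≠ r ∧ ∃ k, G.Adj s k ∧ LinkedIn G (Set.range c)ᶜ w k := by
    intro x y p hy
    induction p with
    | nil => exact fun hx => absurd hy hx.right_mem
    | @cons x z y hxz p ih =>
      intro hx
      have hadj : G.Adj x.1 z.1 := hxz
      by_cases hz : z.1 ∈ Set.range c
      · exact ⟨z, hz, z.2, x, hadj.symm, hx⟩
      · exact ih hy (hx.trans (.of_adj hadj hx.right_mem hz))
  exact key _ _ p hb (.refl hw)

/-- This is a subdivided K₂,₃ with poles `c 0` and `c j`: two paths are the arcs of the cycle,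
marked by `c 1` and `c (m - 1)`, and the third runs outside through `k`. The bounds on `j` keep the
marks away from the poles. -/
theorem false_of_attachments (h : IsPeriodicCycle G m c) [Finite V] (hG : IsOuterplanar G) {j : ℕ}
    (h2 : 2 ≤ j) (hj : j + 2 ≤ m) {k k' : V} (hk : G.Adj (c 0) k) (hk' : G.Adj (c j) k')
    (hl : LinkedIn G (Set.range c)ᶜ k k') : False := by
  have hC : ∀ i, c i ∉ (Set.range c)ᶜ := fun i hi => hi ⟨i, rfl⟩
  have hd : ∀ a b : Fin 3, a ≠ b → Disjoint
      ((![c '' {0, 1}, c '' {0, m - 1}, {c 0, k}] : Fin 3 → Set V) a)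
      ((![c '' Set.Icc 1 j, c '' Set.Icc j (m - 1), insert (c j) (Set.range c)ᶜ] :
        Fin 3 → Set V) b) := by
    have e1 : Disjoint (c '' {0, 1}) (c '' Set.Icc j (m - 1)) :=
      h.disjoint_image (by simp; omega) (by simp; omega) (by simp; omega)
    have e2 : Disjoint (c '' {0, m - 1}) (c '' Set.Icc 1 j) :=
      h.disjoint_image (by simp; omega) (by simp; omega) (by simp; omega)
    have e3 : ∀ I : Set ℕ, (∀ i ∈ I, i < m) → j ∉ I →
        Disjoint (c '' I) (insert (c j) (Set.range c)ᶜ) := fun I hI hjI => by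
      rw [Set.disjoint_left]
      rintro _ ⟨i, hi, rfl⟩ hmem
      rcases hmem with hmem | hmem
      · exact hjI (h.inj (hI i hi) (by omega) hmem ▸ hi)
      · exact hC i hmem
    have e4 : ∀ I : Set ℕ, (∀ i ∈ I, i < m) → 0 ∉ I → Disjoint {c 0, k} (c '' I) := fun I hI h0 => by
      rw [Set.disjoint_left]
      rintro x hx ⟨i, hi, rfl⟩
      rcases hx with hx | hx
      · exact h0 (h.inj (hI i hi) (by omega) hx ▸ hi)
      · exact (hl.left_mem : k ∉ Set.range c) ⟨i, hx⟩
    have e5 := e3 {0, 1} (by simp; omega) (by simp; omega)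
    have e6 := e3 {0, m - 1} (by simp; omega) (by simp; omega)
    have e7 := e4 (Set.Icc 1 j) (by simp; omega) (by simp)
    have e8 := e4 (Set.Icc j (m - 1)) (by simp; omega) (by simp; omega)
    intro a b hab
    fin_cases a <;> fin_cases b <;> first | exact absurd rfl hab | assumption
  refine hG.not_bipartite_two_three ![c 0, c j] ![c 1, c (m - 1), k]
    ![![c '' {0, 1}, c '' {0, m - 1}, {c 0, k}],
      ![c '' Set.Icc 1 j, c '' Set.Icc j (m - 1), insert (c j) (Set.range c)ᶜ]] ?_ ?_
  · have l1 : LinkedIn G (c '' {0, 1}) (c 0) (c 1) :=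
      .of_adj (h.adj 0) ⟨0, by simp⟩ ⟨1, by simp⟩
    have l2 : LinkedIn G (c '' {0, m - 1}) (c 0) (c (m - 1)) :=
      .of_adj h.adj_pred_zero.symm ⟨0, by simp⟩ ⟨m - 1, by simp⟩
    have l3 : LinkedIn G {c 0, k} (c 0) k := .of_adj hk (by simp) (by simp)
    have l4 : LinkedIn G (c '' Set.Icc 1 j) (c j) (c 1) :=
      LinkedIn.symm (h.linkedIn (by omega) fun i h3 h4 => ⟨i, ⟨h3, h4⟩, rfl⟩)
    have l5 : LinkedIn G (c '' Set.Icc j (m - 1)) (c j) (c (m - 1)) :=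
      h.linkedIn (by omega) fun i h3 h4 => ⟨i, ⟨h3, h4⟩, rfl⟩
    have l6 : LinkedIn G (insert (c j) (Set.range c)ᶜ) (c j) k :=
      (LinkedIn.of_adj hk' (by simp) (Or.inr hl.right_mem)).trans
        (hl.symm.mono (Set.subset_insert _ _))
    intro a b
    fin_cases a <;> fin_cases b <;> assumption
  · intro a b a' b' ha hb
    fin_cases a <;> fin_cases a' <;>
      first | exact absurd rfl ha | exact hd b b' hb | exact (hd b' b hb.symm).symm

/-- Two edges of an outerplanar graph that join vertices of a cycle do not cross. -/
theorem not_crossing (h : IsPeriodicCycle G m c) [Finite V] (hG : IsOuterplanar G) {i j k l : ℕ}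
    (hij : i < j) (hjk : j < k) (hkl : k < l) (hl : l < m) (h1 : G.Adj (c i) (c k))
    (h2 : G.Adj (c j) (c l)) : False := by
  -- The branch vertices are `c i, c j, c k, c l`, joined by four arcs of the cycle and two chords.
  -- The arc between `l` and `i` passes through `m - 1` and `0`.
  let I : Fin 4 → Fin 4 → Set ℕ :=
    ![![∅, Set.Icc i j, {i, k}, Set.Iic i ∪ Set.Icc l (m - 1)], ![∅, ∅, Set.Icc j k, {j, l}],
      ![∅, ∅, ∅, Set.Icc k l], ![∅, ∅, ∅, ∅]]
  have hI : ∀ a b, ∀ x ∈ I a b, x < m := by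
    intro a b
    fin_cases a <;> fin_cases b <;> simp [I] <;> omega
  have hJ : ∀ a, (![i, j, k, l] : Fin 4 → ℕ) a < m := by
    intro a
    fin_cases a <;> simp <;> omega
  refine hG.not_complete_four (fun a => c ((![i, j, k, l] : Fin 4 → ℕ) a)) (fun a b => c '' I a b)
    ?_ ?_ ?_
  · have l1 : LinkedIn G (c '' Set.Icc i j) (c i) (c j) :=
      h.linkedIn hij.le fun x h3 h4 => ⟨x, ⟨h3, h4⟩, rfl⟩
    have l2 : LinkedIn G (c '' Set.Icc j k) (c j) (c k) :=
      h.linkedIn hjk.le fun x h3 h4 => ⟨x, ⟨h3, h4⟩, rfl⟩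
    have l3 : LinkedIn G (c '' Set.Icc k l) (c k) (c l) :=
      h.linkedIn hkl.le fun x h3 h4 => ⟨x, ⟨h3, h4⟩, rfl⟩
    have l4 : LinkedIn G (c '' {i, k}) (c i) (c k) := .of_adj h1 ⟨i, by simp⟩ ⟨k, by simp⟩
    have l5 : LinkedIn G (c '' {j, l}) (c j) (c l) := .of_adj h2 ⟨j, by simp⟩ ⟨l, by simp⟩
    have l6 : LinkedIn G (c '' (Set.Iic i ∪ Set.Icc l (m - 1))) (c i) (c l) := by
      have a1 : LinkedIn G (c '' (Set.Iic i ∪ Set.Icc l (m - 1))) (c 0) (c i) :=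
        h.linkedIn (Nat.zero_le _) fun x _ h4 => ⟨x, Or.inl h4, rfl⟩
      have a2 : LinkedIn G (c '' (Set.Iic i ∪ Set.Icc l (m - 1))) (c l) (c (m - 1)) :=
        h.linkedIn (by omega) fun x h3 h4 => ⟨x, Or.inr ⟨h3, h4⟩, rfl⟩
      exact (a1.symm.trans (.of_adj h.adj_pred_zero.symm a1.left_mem a2.right_mem)).trans a2.symm
    intro a b hab
    fin_cases a <;> fin_cases b <;> first | exact absurd hab (by decide) | assumption
  · rintro a b x hab hxa hxb ⟨y, hy, hxy⟩
    obtain rfl := h.inj (hI a b y hy) (hJ x) hxy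
    revert hy
    fin_cases a <;> fin_cases b <;> try exact absurd hab (by decide)
    all_goals fin_cases x <;> try first | exact absurd rfl hxa | exact absurd rfl hxb
    all_goals simp [I]
    all_goals omega
  · intro a b a' b' hab hab' haa hba hbb
    refine h.disjoint_image (hI a b) (hI a' b') ?_
    fin_cases a <;> fin_cases b <;> try exact absurd hab (by decide)
    all_goals fin_cases a' <;> try first | exact absurd haa (by decide) | exact absurd rfl hba
    all_goals fin_cases b' <;> try first | exact absurd hab' (by decide) | exact absurd rfl hbb
    all_goals simp [I]
    all_goals omega

end IsPeriodicCycle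

/-- Take a longest cycle. A vertex off it is linked to two different vertices of the cycle, as
neither is a cut vertex. If these are consecutive, a detour lengthens the cycle; otherwise a K₂,₃
subdivision appears. -/
theorem IsOuterplanar.exists_hamiltonian {V : Type*} [Fintype V] {G : SimpleGraph V}
    (hG : IsOuterplanar G) (h2 : IsTwoConnected G) :
    ∃ m c, IsPeriodicCycle G m c ∧ Function.Surjective c := by
  classical
  have hex : ∃ m, m ≤ Fintype.card V ∧ ∃ c, IsPeriodicCycle G m c := by
    have : Nontrivial V := Fintype.one_lt_card_iff_nontrivial.1 (by have := h2.three_le_card; omega)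
    obtain ⟨a⟩ : Nonempty V := inferInstance
    obtain ⟨b, hab⟩ := h2.connected.preconnected.exists_adj_of_nontrivial a
    exact ⟨2, by have := h2.three_le_card; omega, _, .of_adj hab⟩
  obtain ⟨m₀, hm₀, hc₀⟩ := hex
  obtain ⟨c, hc⟩ := Nat.findGreatest_spec (P := fun m => ∃ c, IsPeriodicCycle G m c) hm₀ hc₀
  have hmax : ∀ m c', IsPeriodicCycle G m c' →
      m ≤ Nat.findGreatest (fun m => ∃ c, IsPeriodicCycle G m c) (Fintype.card V) :=
    fun m c' h => Nat.le_findGreatest h.le_card ⟨c', h⟩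
  generalize Nat.findGreatest (fun m => ∃ c, IsPeriodicCycle G m c) (Fintype.card V) = m at hc hmax
  refine ⟨m, c, hc, fun w => ?_⟩
  by_contra hw
  have hw : w ∉ Set.range c := hw
  obtain ⟨s, ⟨i, rfl⟩, -, k, hk, hwk⟩ :=
    hc.exists_attachment (h2.connected_delete (c 0)) ⟨0, rfl⟩ hw
  have hrot := hc.range_rotate
  obtain ⟨t, ht, hts, k', hk', hwk'⟩ := hc.exists_attachment (h2.connected_delete (c i)) ⟨i, rfl⟩ hw
  have hl := hwk.symm.trans hwk'
  have hc' := hc.rotate i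
  rw [← hrot i] at ht
  obtain ⟨j, hj, rfl⟩ := hc'.exists_lt ht
  have hj0 : j ≠ 0 := by rintro rfl; simp at hts
  by_cases h1 : j = 1
  · subst h1
    obtain ⟨m', c', hm, h'⟩ :=
      hc'.exists_longer (by simpa using hk) hk' (by rw [hrot i]; exact hl)
    have := hmax m' c' h'
    omega
  by_cases h3 : j + 1 = m
  · have e1 : c (1 + j + i) = c i := (hc.eq_iff _ _).2 (by
      rw [show 1 + j + i = i + m by omega]; simp [Nat.ModEq])
    have e2 : Set.range (fun x => c (x + j + i)) = Set.range c := by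
      rw [← hrot (j + i)]; simp only [add_assoc]
    obtain ⟨m', c', hm, h'⟩ := (hc'.rotate j).exists_longer (k := k') (k' := k)
      (by simpa using hk') (by simpa [e1] using hk) (by rw [e2]; exact hl.symm)
    have := hmax m' c' h'
    omega
  · exact hc'.false_of_attachments hG (show 2 ≤ j by omega) (by omega) (by simpa using hk) hk'
      (by rw [hrot i]; exact hl)

/-! ### From the Hamiltonian cycle to the orientation -/

namespace IsPeriodicCycle

variable {V : Type*} {G : SimpleGraph V} [DecidableRel G.Adj] {m : ℕ} {c : ℕ → V}

/-- The edges of `G` as increasing pairs of positions on a Hamiltonian cycle. -/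
def edgePairs (G : SimpleGraph V) [DecidableRel G.Adj] (m : ℕ) (c : ℕ → V) : Finset (ℕ × ℕ) :=
  (Finset.range m ×ˢ Finset.range m).filter fun a => a.1 < a.2 ∧ G.Adj (c a.1) (c a.2)

theorem mem_edgePairs {i j : ℕ} : (i, j) ∈ edgePairs G m c ↔ i < j ∧ j < m ∧ G.Adj (c i) (c j) := by
  simp only [edgePairs, Finset.mem_filter, Finset.mem_product, Finset.mem_range]
  constructor
  · rintro ⟨⟨-, h1⟩, h2, h3⟩; exact ⟨h2, h1, h3⟩
  · rintro ⟨h1, h2, h3⟩; exact ⟨⟨by omega, h2⟩, h1, h3⟩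

theorem isDissection [Finite V] (h : IsPeriodicCycle G m c) (hm : 3 ≤ m) (hG : IsOuterplanar G) :
    IsDissection m (edgePairs G m c) where
  lt := fun ⟨_, _⟩ ha => (mem_edgePairs.1 ha).1
  lt_card := fun ⟨_, _⟩ ha => (mem_edgePairs.1 ha).2.1
  side_mem i hi := mem_edgePairs.2 ⟨by omega, hi, h.adj i⟩
  root_mem := mem_edgePairs.2 ⟨by omega, by omega, h.adj_pred_zero.symm⟩
  noncrossing i j k l hij hjk hkl h1 h2 := by
    rw [mem_edgePairs] at h1 h2
    exact h.not_crossing hG hij hjk hkl h2.2.1 h1.2.2 h2.2.2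

theorem pairDegree_edgePairs [Fintype V] (h : IsPeriodicCycle G m c) (hs : Function.Surjective c) {k : ℕ}
    (hk : k < m) : pairDegree (edgePairs G m c) k = G.degree (c k) := by
  rw [pairDegree, ← SimpleGraph.card_neighborFinset_eq_degree]
  refine Finset.card_bij (fun a _ => if a.1 = k then c a.2 else c a.1) ?_ ?_ ?_
  · rintro ⟨i, j⟩ ha
    rw [Finset.mem_filter, mem_edgePairs] at ha
    obtain ⟨⟨h1, h2, h3⟩, h4⟩ := ha
    rw [SimpleGraph.mem_neighborFinset]
    by_cases h5 : i = k
    · subst h5; simpa using h3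
    · obtain rfl : j = k := h4.resolve_left h5
      simpa [h5] using h3.symm
  · rintro ⟨i, j⟩ ha ⟨i', j'⟩ ha' e
    rw [Finset.mem_filter, mem_edgePairs] at ha ha'
    obtain ⟨⟨h1, h2, -⟩, h4⟩ := ha
    obtain ⟨⟨h1', h2', -⟩, h4'⟩ := ha'
    simp only at e h4 h4'
    rw [Prod.mk.injEq]
    split_ifs at e with h5 h6 h6
    · have := h.inj h2 h2' e; omega
    · have := h.inj h2 (by omega) e; omega
    · have := h.inj (by omega) h2' e; omega
    · have := h.inj (by omega) (by omega) e; omega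
  · intro u hu
    rw [SimpleGraph.mem_neighborFinset] at hu
    obtain ⟨i, hi, rfl⟩ := h.exists_lt (hs u)
    have hne : i ≠ k := by rintro rfl; exact hu.ne rfl
    rcases hne.lt_or_gt with h1 | h1
    · refine ⟨(i, k), ?_, by simp [hne]⟩
      rw [Finset.mem_filter, mem_edgePairs]
      exact ⟨⟨h1, hk, hu.symm⟩, Or.inr rfl⟩
    · refine ⟨(k, i), ?_, by simp⟩
      rw [Finset.mem_filter, mem_edgePairs]
      exact ⟨⟨h1, hi, hu⟩, Or.inl rfl⟩

theorem isTruncatedDegreeAT_of_three_le_degree [Fintype V] [DecidableEq V] (h : IsPeriodicCycle G m c) (hm : 3 ≤ m)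
    (hs : Function.Surjective c) (hG : IsOuterplanar G) (h3 : 3 ≤ G.degree (c 0)) :
    IsTruncatedDegreeAT 5 G := by
  obtain ⟨d, hd, hdeg⟩ := (h.isDissection hm hG).exists_coeff_ne_zero hm
    (by rwa [h.pairDegree_edgePairs hs (by omega)])
  have hlab : ∀ v, ∃ i, i < m ∧ c i = v := fun v => h.exists_lt (hs v)
  choose lab hlt hlab using hlab
  have hinj : Function.Injective lab := Function.LeftInverse.injective hlab
  have hlc : ∀ i < m, lab (c i) = i := fun i hi => h.inj (hlt _) hi (hlab _)
  have hmem : ∀ u v, (u, v) ∈ Finset.univ.filter (fun a : V × V => lab a.1 < lab a.2 ∧ G.Adj a.1 a.2)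
      ↔ lab u < lab v ∧ G.Adj u v := fun u v => by simp
  set E : Finset (V × V) := Finset.univ.filter fun a : V × V => lab a.1 < lab a.2 ∧ G.Adj a.1 a.2
  have hE : IsOrientation G E := by
    refine ⟨fun u v huv => ((hmem u v).1 huv).2, fun u v huv => ?_⟩
    rw [hmem, hmem]
    rcases (hinj.ne huv.ne).lt_or_gt with h1 | h1
    · exact Or.inl ⟨⟨h1, huv⟩, fun h2 => by omega⟩
    · exact Or.inr ⟨⟨h1, huv.symm⟩, fun h2 => by omega⟩
  have himg : E.image (Prod.map lab lab) = edgePairs G m c := by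
    ext ⟨i, j⟩
    rw [Finset.mem_image, mem_edgePairs]
    constructor
    · rintro ⟨⟨u, v⟩, huv, e⟩
      rw [hmem] at huv
      simp only [Prod.map_apply, Prod.mk.injEq] at e
      obtain ⟨rfl, rfl⟩ := e
      rw [hlab, hlab]
      exact ⟨huv.1, hlt v, huv.2⟩
    · rintro ⟨h1, h2, h4⟩
      have e1 := hlc i (by omega)
      have e2 := hlc j h2
      exact ⟨(c i, c j), (hmem _ _).2 ⟨by rwa [e1, e2], h4⟩, by simp [e1, e2]⟩
  -- Renaming vertices by their positions carries the polynomial of `G` to that of the dissection,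
  -- so the monomial found there can be pulled back.
  have hP : rename lab (graphPoly E) = graphPoly (edgePairs G m c) := by
    rw [← himg, graphPoly, graphPoly,
      Finset.prod_image fun a _ b _ hab => (hinj.prodMap hinj) hab, map_prod]
    simp
  rw [← hP] at hd
  obtain ⟨d', rfl, hd'⟩ := coeff_rename_ne_zero _ _ _ hd
  refine isAT_of_coeff_ne_zero hE hd' fun v => ?_
  have := hdeg (lab v) (hlt v)
  rwa [Finsupp.mapDomain_apply hinj, h.pairDegree_edgePairs hs (hlt v), hlab] at this

theorem pair_subset_neighborFinset [Fintype V] [DecidableEq V] (h : IsPeriodicCycle G m c) (i : ℕ) :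
    {c i, c (i + 2)} ⊆ G.neighborFinset (c (i + 1)) := by
  intro x hx
  rw [SimpleGraph.mem_neighborFinset]
  rcases Finset.mem_insert.1 hx with rfl | hx
  · exact (h.adj i).symm
  · rw [Finset.mem_singleton.1 hx]; exact h.adj (i + 1)

theorem two_le_degree [Fintype V] (h : IsPeriodicCycle G m c) (hm : 3 ≤ m) {i : ℕ} :
    2 ≤ G.degree (c (i + 1)) := by
  classical
  rw [← Finset.card_pair (h.apply_ne_apply_add_two hm i),
    ← SimpleGraph.card_neighborFinset_eq_degree]
  exact Finset.card_le_card (h.pair_subset_neighborFinset i)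

/-- If all degrees are at most two, then the neighbours of a vertex of the cycle are the two
vertices next to it. -/
theorem adj_iff_of_degree_le_two [Fintype V] (h : IsPeriodicCycle G m c) (hm : 3 ≤ m)
    (hdeg : ∀ v, G.degree v ≤ 2) {i : ℕ} {v : V} :
    G.Adj (c (i + 1)) v ↔ v = c i ∨ v = c (i + 2) := by
  classical
  have heq := Finset.eq_of_subset_of_card_le (h.pair_subset_neighborFinset i) (by
    rw [Finset.card_pair (h.apply_ne_apply_add_two hm i),
      SimpleGraph.card_neighborFinset_eq_degree]
    exact hdeg _)
  rw [← SimpleGraph.mem_neighborFinset, ← heq]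
  simp

theorem isOddCycle [Fintype V] (h : IsPeriodicCycle G m c) (hm : 3 ≤ m) (hs : Function.Surjective c)
    (hdeg : ∀ v, G.degree v ≤ 2) (hodd : Odd m) : IsOddCycle G := by
  obtain ⟨n, rfl⟩ : ∃ n, m = n + 2 := ⟨m - 2, by omega⟩
  have hbij : Function.Bijective fun i : Fin (n + 2) => c i := by
    refine ⟨fun i j hij => Fin.ext (h.inj i.2 j.2 hij), fun v => ?_⟩
    obtain ⟨i, hi, rfl⟩ := h.exists_lt (hs v)
    exact ⟨⟨i, hi⟩, rfl⟩
  have hsucc : ∀ i : Fin (n + 2), c ((i + 1 : Fin (n + 2)) : ℕ) = c (i + 1) := fun i => by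
    rw [Fin.val_add, Fin.val_one, h.apply_mod]
  refine ⟨n + 2, hm, hodd, ⟨RelIso.symm ⟨Equiv.ofBijective _ hbij, fun {i j} => ?_⟩⟩⟩
  simp only [Equiv.ofBijective_apply]
  rw [SimpleGraph.cycleGraph_adj]
  constructor
  · intro hij
    -- A full period is added before subtracting 1, so that the predecessor of position 0 is
    -- correct.
    have e := (h.adj_iff_of_degree_le_two hm hdeg (i := i + (n + 2) - 1) (v := c j)).1 (by
      rwa [show (i : ℕ) + (n + 2) - 1 + 1 = i + (n + 2) by omega,
        show c (i + (n + 2)) = c i from (h.eq_iff _ _).2 (by simp [Nat.ModEq])])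
    rcases e with e | e
    · left
      rw [sub_eq_iff_eq_add, add_comm 1 j]
      apply hbij.1
      simp only [hsucc]
      have := (h.eq_iff _ _).2 (((h.eq_iff _ _).1 e).add_right 1)
      rw [this]
      exact (h.eq_iff _ _).2 (by
        rw [show (i : ℕ) + (n + 2) - 1 + 1 = i + (n + 2) by omega]; simp [Nat.ModEq])
    · right
      rw [sub_eq_iff_eq_add, add_comm 1 i]
      apply hbij.1
      simp only [hsucc]
      rw [e]
      exact (h.eq_iff _ _).2 (by
        rw [show (i : ℕ) + (n + 2) - 1 + 2 = i + 1 + (n + 2) by omega]; simp [Nat.ModEq])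
  · rintro (e | e)
    · rw [sub_eq_iff_eq_add, add_comm 1 j] at e
      subst e
      rw [hsucc]
      exact (h.adj j).symm
    · rw [sub_eq_iff_eq_add, add_comm 1 i] at e
      subst e
      rw [hsucc]
      exact h.adj i

theorem isTruncatedDegreeAT_of_even [Fintype V] [DecidableEq V] (h : IsPeriodicCycle G m c) (hm : 3 ≤ m)
    (hs : Function.Surjective c) (hdeg : ∀ v, G.degree v ≤ 2) (heven : Even m) :
    IsTruncatedDegreeAT 5 G := by
  have hnext : ∀ {i j}, c i = c j → c (i + 1) = c (j + 1) := fun e =>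
    (h.eq_iff _ _).2 (((h.eq_iff _ _).1 e).add_right 1)
  set D : Finset (V × V) := (Finset.range m).image fun i => (c i, c (i + 1)) with hD
  have hmem : ∀ u v, (u, v) ∈ D ↔ ∃ i, c i = u ∧ c (i + 1) = v := fun u v => by
    simp only [hD, Finset.mem_image, Finset.mem_range, Prod.mk.injEq]
    constructor
    · rintro ⟨i, -, h1⟩; exact ⟨i, h1⟩
    · rintro ⟨i, rfl, rfl⟩
      exact ⟨i % m, Nat.mod_lt _ (by omega), h.apply_mod i, hnext (h.apply_mod i)⟩
  have hcard : D.card = m := by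
    rw [hD, Finset.card_image_of_injOn, Finset.card_range]
    intro i hi j hj e
    exact h.inj (by simpa using hi) (by simpa using hj) (Prod.mk.inj e).1
  have hor : IsOrientation G D := by
    refine ⟨fun u v huv => ?_, fun u v huv => ?_⟩
    · obtain ⟨i, rfl, rfl⟩ := (hmem u v).1 huv
      exact h.adj i
    · have hnot : ∀ {u v}, (u, v) ∈ D → (v, u) ∉ D := fun h1 h2 => by
        obtain ⟨i, rfl, rfl⟩ := (hmem _ _).1 h1
        obtain ⟨j, h3, h4⟩ := (hmem _ _).1 h2
        have h5 := (h.eq_iff _ _).1 ((hnext h3).symm.trans h4)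
        rw [Nat.add_assoc, Nat.add_modEq_left_iff] at h5
        have := Nat.le_of_dvd (by omega) h5
        omega
      obtain ⟨i, rfl⟩ := h.exists_succ_eq (hs u)
      rcases (h.adj_iff_of_degree_le_two hm hdeg).1 huv with rfl | rfl
      · have : (c i, c (i + 1)) ∈ D := (hmem _ _).2 ⟨i, rfl, rfl⟩
        exact Or.inr ⟨this, hnot this⟩
      · have : (c (i + 1), c (i + 2)) ∈ D := (hmem _ _).2 ⟨i + 1, rfl, rfl⟩
        exact Or.inl ⟨this, hnot this⟩
  have hsub : ∀ H ∈ eulerianSubdigraphs D, H = ∅ ∨ H = D := by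
    intro H hH
    simp only [eulerianSubdigraphs, Finset.mem_filter, Finset.mem_powerset] at hH
    obtain ⟨hHD, hHe⟩ := hH
    rcases H.eq_empty_or_nonempty with h0 | ⟨⟨u, v⟩, huv⟩
    · exact Or.inl h0
    right
    refine Finset.Subset.antisymm hHD ?_
    obtain ⟨i, rfl, rfl⟩ := (hmem u v).1 (hHD huv)
    -- An arc of `H` entering a vertex forces one leaving it, and `D` has only one candidate; so a
    -- nonempty `H` runs around the whole cycle.
    have hstep : ∀ j, (c j, c (j + 1)) ∈ H → (c (j + 1), c (j + 1 + 1)) ∈ H := fun j hj => by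
      have h1 : 0 < inDeg H (c (j + 1)) :=
        Finset.card_pos.2 ⟨_, Finset.mem_filter.2 ⟨hj, rfl⟩⟩
      rw [← hHe] at h1
      obtain ⟨⟨a, b⟩, hab⟩ := Finset.card_pos.1 h1
      obtain ⟨h2, h3⟩ := Finset.mem_filter.1 hab
      obtain ⟨l, rfl, rfl⟩ := (hmem _ _).1 (hHD h2)
      simp only at h3
      rwa [hnext h3, h3] at h2
    have hall : ∀ k, (c (i + k), c (i + k + 1)) ∈ H := fun k => by
      induction k with
      | zero => exact huv
      | succ k ih => exact hstep _ ih
    rintro ⟨a, b⟩ hab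
    obtain ⟨j, rfl, rfl⟩ := (hmem a b).1 hab
    obtain ⟨k, hk⟩ : c j ∈ Set.range fun k => c (k + i) := by
      rw [h.range_rotate]; exact ⟨j, rfl⟩
    have e : c (i + k) = c j := by rw [add_comm]; exact hk
    have := hall k
    rwa [hnext e, e] at this
  have hdiff : eulerianDiff D ≠ 0 := by
    have h1 : oddEulerian D = ∅ := by
      refine Finset.filter_false_of_mem fun H hH => ?_
      rw [Nat.not_odd_iff_even]
      rcases hsub H hH with rfl | rfl
      · simp
      · rwa [hcard]
    have h2 : ∅ ∈ evenEulerian D := by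
      simp only [evenEulerian, eulerianSubdigraphs, Finset.mem_filter]
      exact ⟨⟨by simp, fun v => rfl⟩, by simp⟩
    have h3 := Finset.card_pos.2 ⟨_, h2⟩
    unfold eulerianDiff
    rw [h1, Finset.card_empty]
    omega
  refine ⟨D, ⟨hor, hdiff⟩, fun v => ?_⟩
  have h1 : outDeg D v ≤ 1 := by
    refine Finset.card_le_one.2 ?_
    rintro ⟨a, b⟩ hab ⟨a', b'⟩ hab'
    rw [Finset.mem_filter, hmem] at hab hab'
    obtain ⟨⟨i, rfl, rfl⟩, rfl⟩ := hab
    obtain ⟨⟨j, rfl, rfl⟩, e⟩ := hab'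
    simp only at e
    rw [e, hnext e]
  have h2 : 2 ≤ G.degree v := by
    obtain ⟨i, rfl⟩ := h.exists_succ_eq (hs v)
    exact h.two_le_degree hm
  simp only
  omega

end IsPeriodicCycle

theorem theorem1p2 {V : Type*} [Fintype V] [DecidableEq V] (G : SimpleGraph V)
    [DecidableRel G.Adj] (h2 : IsTwoConnected G) (hout : IsOuterplanar G)
    (hodd : ¬ IsOddCycle G) : IsTruncatedDegreeAT 5 G := by
  obtain ⟨m, c, hc, hs⟩ := hout.exists_hamiltonian h2
  have hm : 3 ≤ m := by
    refine h2.three_le_card.trans ?_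
    have : Function.Surjective fun i : Fin m => c i := fun v => by
      obtain ⟨i, hi, rfl⟩ := hc.exists_lt (hs v)
      exact ⟨⟨i, hi⟩, rfl⟩
    simpa using Fintype.card_le_of_surjective _ this
  by_cases hdeg : ∀ v, G.degree v ≤ 2
  · exact hc.isTruncatedDegreeAT_of_even hm hs hdeg
      (Nat.not_odd_iff_even.1 fun ho => hodd (hc.isOddCycle hm hs hdeg ho))
  · push Not at hdeg
    obtain ⟨v, hv⟩ := hdeg
    obtain ⟨i, rfl⟩ := hs v
    exact (hc.rotate i).isTruncatedDegreeAT_of_three_le_degree hm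
      (Set.range_eq_univ.1 ((hc.range_rotate i).trans hs.range_eq)) hout (by rw [zero_add]; exact hv)
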